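/- Let $r \ge 2$ be an integer and let $\gamma > 0$ be real. Then there is a constant $c = c(r,\gamma) > 0$, depending only on $r$ and $\gamma$, such that the following holds for all integers $n \ge 1$ and all reals $p \in (0,1]$ and $t > 0$. Let $X = X_{r,n,p}$ be the number of copies of the star $K_{1,r}$ (that is, of not necessarily induced subgraphs isomorphic to $K_{1,r}$) in the binomial random graph $G_{n,p}$. Set $$\mu := \mathbb{E} X, \qquad \Lambda := \mu\bigl(1+(np)^{r-1}\bigr), \qquad \varphi(x) := (1+x)\log(1+x) - x,$$ $$M := \max\bigl\{t^{1/r},\, t/n^{r-1}\bigr\}, \qquad s := \log(e/p^{\gamma}).$$ Suppose that either $np \notin (n^{-\gamma}, \gamma \log n)$ (an open interval, empty if $n^{-\gamma} \ge \gamma\log n$), or $$\frac{t^2}{\mu} \;\ge\; \mathbf{1}_{\{t \le \min\{\mu, n^r\}\}} \; \gamma \, \min\bigl\{ t^{1/r} (\log n)^r, \; M s (\log n)^{r-1} \bigr\}.$$ Then $$\mathbb{P}(X \ge \mu + t) \;\le\; (1+n^{-1}) \exp\Bigl( - c \, \min\Bigl\{ \frac{\varphi(t/\mu)\,\mu^2}{\Lambda},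 \; M \log(e/p) \Bigr\} \Bigr).$$ (If $n \le r$ then $X = 0$ and $\mu = 0$; quotients with denominator $0$ are then read as $0$, and the inequality is trivial since its left-hand side is $0$.) -/

import Mathlib

open MeasureTheory SimpleGraph

noncomputable section

/-- The number `X` of (unlabelled, not necessarily induced) copies of the star `K_{1,r}` in `G`,
that is, of subgraphs of `G` isomorphic to `K_{1,r}`. -/
def starCount (r : ℕ) {n : ℕ} (G : SimpleGraph (Fin n)) : ℕ :=
  G.copyCount (completeBipartiteGraph (Fin 1) (Fin r))

/-- The mean `μ = E X` of the number of copies of `K_{1,r}` in the binomial random graph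
`G_{n,p}`. -/
def starMean (r n : ℕ) (p : unitInterval) : ℝ :=
  ∫ G, (starCount r G : ℝ) ∂(binomialRandom (Fin n) p)

/-- The upper tail probability `P(X ≥ x)` in the binomial random graph `G_{n,p}`. -/
def starUpperTail (r n : ℕ) (p : unitInterval) (x : ℝ) : ℝ :=
  (binomialRandom (Fin n) p).real {G | x ≤ (starCount r G : ℝ)}

/-- `Λ = μ (1 + (np)^{r-1})`. -/
def starLambda (r n : ℕ) (p : unitInterval) : ℝ :=
  starMean r n p * (1 + ((n : ℝ) * (p : ℝ)) ^ (r - 1))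

/-- `φ(x) = (1 + x) log (1 + x) - x`. -/
def phi (x : ℝ) : ℝ := (1 + x) * Real.log (1 + x) - x

/-- `M = M(t) = max {t^{1/r}, t / n^{r-1}}`. -/
def clusterM (r n : ℕ) (t : ℝ) : ℝ := max (t ^ (1 / (r : ℝ))) (t / (n : ℝ) ^ (r - 1))

/-- `s = s(γ) = log (e / p^γ)`. -/
def logFactor (γ : ℝ) (p : unitInterval) : ℝ := Real.log (Real.exp 1 / (p : ℝ) ^ γ)

/-- The assumed lower bound on `t`:
`t² / μ ≥ 1{t ≤ min {μ, n^r}} γ min {t^{1/r} (log n)^r, M s (log n)^{r-1}}`. -/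
def DeviationCondition (r n : ℕ) (γ : ℝ) (p : unitInterval) (t : ℝ) : Prop :=
  (if t ≤ min (starMean r n p) ((n : ℝ) ^ r) then (1 : ℝ) else 0) *
      (γ * min (t ^ (1 / (r : ℝ)) * Real.log n ^ r)
        (clusterM r n t * logFactor γ p * Real.log n ^ (r - 1)))
    ≤ t ^ 2 / starMean r n p

end

/-! Write X as the sum over vertices v of C(deg v, r). Each degree is Bin(n-1, p), and an edge
influences only the two degrees at its ends. Finner's inequality with exponents two
(`bernSum_prod_le_prod_sqrt`) therefore treats the degrees as independent at the price of doubling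
the exponent: E exp(Σ g(deg v)) ≤ (E exp(2g(Bin)))^{n/2}. The upper tail becomes a question about
one binomial variable.

A binomial coefficient of a binomial variable has no useful exponential moment of the required
order, so degrees are truncated at a level K. `starUpperTail_le` adds the union bound for a degree
above K to the exponential Markov bound, with parameter λ, for the truncated sum. If the one-degree
moment generating function at 2λ is at most exp(2λm₀ + λt/n), with m₀ = μ/n, then Markov's bound is
exp(-λt/2). With I the minimum in the theorem, λ is a small multiple of I/t. The two terms of the
minimum then say λ(1+(np)^{r-1}) ≲ log(1+t/μ) and λ min(t^{1/r}, n)^{r-1} ≲ log(e/p), and these two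
facts are all that is used about λ.

The moment generating function is expanded to second order. For np ≤ 1 (`exists_mgf_le_of_sparse`)
this is done for C(d, r) itself, whose weighted second moment has order (np)^r. For np ≥ 1
(`exists_mgf_le_of_dense`) the tangent line of C(d, r) near the mean is removed first: the linear
part is an ordinary binomial exponential moment, and the expansion is applied to the nonnegative
quadratic remainder. In both cases large d is controlled by the growth condition λd^{r-1} ≲
log(d/(np)) for d ≤ K.

It remains to find K for which the growth condition holds below K and a degree above K has
probability at most n^{-2}exp(-λt/2) (`exists_isTruncation`). The natural scale is t^{1/r}, the
degree at which one vertex carries about t stars, raised to a level where Chernoff's bound also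
absorbs n². -/

/-! ### Copies of a star as pairs of a centre and a leaf set -/

section StarCopies

variable {V : Type*} (G : SimpleGraph V)

/-- The star in `G` with center `v` and set of leaves `S`. -/
def starSubgraph (v : V) (S : Finset V) (hS : ∀ s ∈ S, G.Adj v s) : G.Subgraph where
  verts := insert v (S : Set V)
  Adj x y := (x = v ∧ y ∈ S) ∨ (y = v ∧ x ∈ S)
  adj_sub := by
    rintro x y (⟨rfl, h⟩ | ⟨rfl, h⟩)
    · exact hS _ h
    · exact (hS _ h).symm
  edge_vert := by
    rintro x y (⟨rfl, h⟩ | ⟨rfl, h⟩)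
    · exact Set.mem_insert _ _
    · exact Set.mem_insert_of_mem _ h
  symm := ⟨fun x y h => h.symm⟩

/-- With two leaves, one of them differs from w, and the edge from v to it can only be a star edge
at w if v = w. A single edge would have two possible centres, hence the bound on the number of
leaves. -/
lemma starSubgraph_injective {v w : V} {S T : Finset V} (hS : ∀ s ∈ S, G.Adj v s)
    (hT : ∀ s ∈ T, G.Adj w s) (hcard : 2 ≤ S.card)
    (h : starSubgraph G v S hS = starSubgraph G w T hT) : v = w ∧ S = T := by
  have hadj : ∀ x y, ((x = v ∧ y ∈ S) ∨ (y = v ∧ x ∈ S)) ↔ ((x = w ∧ y ∈ T) ∨ (y = w ∧ x ∈ T)) := by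
    intro x y
    have := congrArg (fun H : G.Subgraph => H.Adj x y) h
    exact iff_of_eq this
  have hv : v = w := by
    obtain ⟨s, hs, hsw⟩ := Finset.exists_mem_ne (by omega : 1 < S.card) w
    rcases (hadj v s).1 (Or.inl ⟨rfl, hs⟩) with h | h
    · exact h.1
    · exact absurd h.1 hsw
  subst hv
  refine ⟨rfl, ?_⟩
  ext y
  have hvS : v ∉ S := fun h => (hS v h).ne rfl
  have hvT : v ∉ T := fun h => (hT v h).ne rfl
  have := hadj v y
  grind

lemma nonempty_iso_starSubgraph {r : ℕ} {v : V} {S : Finset V} (hS : ∀ s ∈ S, G.Adj v s)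
    (hcard : S.card = r) :
    Nonempty (completeBipartiteGraph (Fin 1) (Fin r) ≃g (starSubgraph G v S hS).coe) := by
  have hvS : v ∉ S := fun h => (hS v h).ne rfl
  let e : Fin r ≃ S := (S.equivFinOfCardEq hcard).symm
  let g : Fin 1 ⊕ Fin r → (starSubgraph G v S hS).verts :=
    Sum.elim (fun _ => ⟨v, Set.mem_insert _ _⟩)
      (fun i => ⟨(e i : V), Set.mem_insert_of_mem _ (e i).2⟩)
  have hg : Function.Bijective g := by
    constructor
    · rintro (a | a) (b | b) hab
      · rw [Subsingleton.elim a b]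
      · have hab' : v = (e b : V) := congrArg (fun z : (starSubgraph G v S hS).verts => (z : V)) hab
        exact absurd (hab' ▸ (e b).2) hvS
      · have hab' : (e a : V) = v := congrArg (fun z : (starSubgraph G v S hS).verts => (z : V)) hab
        exact absurd (hab' ▸ (e a).2) hvS
      · have hab' : (e a : V) = (e b : V) := congrArg (fun z : (starSubgraph G v S hS).verts => (z : V)) hab
        rw [e.injective (Subtype.ext hab')]
    · rintro ⟨x, hx⟩
      rcases hx with rfl | hx
      · exact ⟨Sum.inl 0, rfl⟩
      · refine ⟨Sum.inr (e.symm ⟨x, hx⟩), ?_⟩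
        simp [g]
  refine ⟨⟨Equiv.ofBijective g hg, ?_⟩⟩
  intro a b
  change (((g a : V) = v ∧ (g b : V) ∈ S) ∨ ((g b : V) = v ∧ (g a : V) ∈ S)) ↔ _
  rcases a with a | a <;> rcases b with b | b
  · simp [g, hvS]
  · simp [g]
  · simp [g]
  · have ha : (e a : V) ≠ v := fun h => hvS (h ▸ (e a).2)
    have hb : (e b : V) ≠ v := fun h => hvS (h ▸ (e b).2)
    simp [g, ha, hb]

lemma exists_starSubgraph_eq [DecidableEq V] {r : ℕ} (H : G.Subgraph)
    (h : Nonempty (completeBipartiteGraph (Fin 1) (Fin r) ≃g H.coe)) :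
    ∃ (v : V) (S : Finset V) (hS : ∀ s ∈ S, G.Adj v s), S.card = r ∧
      starSubgraph G v S hS = H := by
  obtain ⟨e⟩ := h
  let c : V := (e (Sum.inl 0) : V)
  let ℓ : Fin r → V := fun i => (e (Sum.inr i) : V)
  have hℓ : Function.Injective ℓ := by
    intro i j hij
    have := e.injective (Subtype.ext hij)
    simpa using this
  have hadj : ∀ i, H.Adj c (ℓ i) := by
    intro i
    have : H.coe.Adj (e (Sum.inl 0)) (e (Sum.inr i)) := e.map_adj_iff.2 (by simp)
    exact this
  have key : ∀ x y, H.Adj x y → ((x = c ∧ y ∈ Finset.univ.image ℓ) ∨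
      (y = c ∧ x ∈ Finset.univ.image ℓ)) := by
    intro x y hxy
    obtain ⟨a, ha⟩ := e.surjective ⟨x, H.edge_vert hxy⟩
    obtain ⟨b, hb⟩ := e.surjective ⟨y, H.edge_vert hxy.symm⟩
    have hab : (completeBipartiteGraph (Fin 1) (Fin r)).Adj a b := by
      rw [← e.map_adj_iff, ha, hb]; exact hxy
    have hx : x = (e a : V) := by rw [ha]
    have hy : y = (e b : V) := by rw [hb]
    rcases a with a | a <;> rcases b with b | b
    · simp at hab
    · left
      rw [Subsingleton.elim a 0] at hx
      exact ⟨hx, by rw [hy]; simp [ℓ]⟩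
    · right
      rw [Subsingleton.elim b 0] at hy
      exact ⟨hy, by rw [hx]; simp [ℓ]⟩
    · simp at hab
  refine ⟨c, Finset.univ.image ℓ, ?_, ?_, ?_⟩
  · intro s hs
    obtain ⟨i, -, rfl⟩ := Finset.mem_image.1 hs
    exact (hadj i).adj_sub
  · rw [Finset.card_image_of_injective _ hℓ]; simp
  · refine SimpleGraph.Subgraph.ext ?_ ?_
    · ext x
      constructor
      · rintro (rfl | hx)
        · exact (e (Sum.inl 0)).2
        · obtain ⟨i, -, rfl⟩ := Finset.mem_image.1 (Finset.mem_coe.1 hx)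
          exact (e (Sum.inr i)).2
      · intro hx
        obtain ⟨a, ha⟩ := e.surjective ⟨x, hx⟩
        have hx' : x = (e a : V) := by rw [ha]
        rcases a with a | a
        · rw [Subsingleton.elim a 0] at hx'
          exact Or.inl hx'
        · right
          rw [hx']; simp [ℓ]
    · ext x y
      constructor
      · rintro (⟨rfl, h⟩ | ⟨rfl, h⟩)
        · obtain ⟨i, -, rfl⟩ := Finset.mem_image.1 h
          exact hadj i
        · obtain ⟨i, -, rfl⟩ := Finset.mem_image.1 h
          exact (hadj i).symm
      · exact key x y

end StarCopies

/-- Stars are sorted by their centre, which is unique because r ≥ 2; for r = 1 the sum would count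
every edge twice. -/
lemma starCount_eq_sum_choose_degree {r n : ℕ} (hr : 2 ≤ r) (G : SimpleGraph (Fin n))
    [DecidableRel G.Adj] : starCount r G = ∑ v, (G.degree v).choose r := by
  classical
  have h1 : ∑ v, (G.degree v).choose r =
      (Finset.univ.sigma fun v => (G.neighborFinset v).powersetCard r).card := by
    simp [Finset.card_sigma, Finset.card_powersetCard]
  rw [h1, starCount, copyCount]
  symm
  have hmem : ∀ q : (Σ _ : Fin n, Finset (Fin n)),
      q ∈ (Finset.univ.sigma fun v => (G.neighborFinset v).powersetCard r) →
        (∀ s ∈ q.2, G.Adj q.1 s) ∧ q.2.card = r := by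
    intro q hq
    simp only [Finset.mem_sigma, Finset.mem_univ, true_and, Finset.mem_powersetCard] at hq
    exact ⟨fun s hs => by simpa using hq.1 hs, hq.2⟩
  refine Finset.card_bij (fun q hq => starSubgraph G q.1 q.2 (hmem q hq).1) ?_ ?_ ?_
  · intro q hq
    simp only [Finset.mem_filter, Finset.mem_univ, true_and]
    exact nonempty_iso_starSubgraph G _ (hmem q hq).2
  · rintro ⟨v, S⟩ hq ⟨w, T⟩ hq' h
    obtain ⟨rfl, rfl⟩ := starSubgraph_injective G (hmem _ hq).1 (hmem _ hq').1
      (by rw [(hmem _ hq).2]; exact hr) h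
    rfl
  · intro H hH
    simp only [Finset.mem_filter, Finset.mem_univ, true_and] at hH
    obtain ⟨v, S, hS, hc, hH⟩ := exists_starSubgraph_eq G H hH
    refine ⟨⟨v, S⟩, ?_, hH⟩
    simp only [Finset.mem_sigma, Finset.mem_univ, true_and, Finset.mem_powersetCard]
    exact ⟨fun s hs => by simpa using hS s hs, hc⟩

instance instMeasurableSingletonClassSimpleGraph {V : Type*} [Finite V] :
    MeasurableSingletonClass (SimpleGraph V) where
  measurableSet_singleton G := by
    have h : ({G} : Set (SimpleGraph V)) = edgeSet ⁻¹' {G.edgeSet} := by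
      ext H; simp
    rw [h]
    exact measurable_edgeSet (measurableSet_singleton _)

/-! ### Expectations over random subsets and Finner's inequality -/

section BernSum

variable {α : Type*}

/-- The expectation of `F` at a random subset of `E` containing each element independently with
probability `p`. -/
noncomputable def bernSum (p : ℝ) (E : Finset α) (F : Finset α → ℝ) : ℝ :=
  ∑ S ∈ E.powerset, p ^ S.card * (1 - p) ^ (E.card - S.card) * F S

lemma bernSum_empty (p : ℝ) (F : Finset α → ℝ) : bernSum p ∅ F = F ∅ := by
  simp [bernSum]

lemma bernSum_insert [DecidableEq α] (p : ℝ) {E : Finset α} {e : α} (he : e ∉ E) (F : Finset α → ℝ) :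
    bernSum p (insert e E) F =
      (1 - p) * bernSum p E F + p * bernSum p E (fun S => F (insert e S)) := by
  simp only [bernSum]
  rw [Finset.sum_powerset_insert he, Finset.mul_sum, Finset.mul_sum]
  congr 1
  · refine Finset.sum_congr rfl fun S hS => ?_
    have hc := Finset.card_le_card (Finset.mem_powerset.1 hS)
    rw [Finset.card_insert_of_notMem he, Nat.sub_add_comm hc, pow_succ]
    ring
  · refine Finset.sum_congr rfl fun S hS => ?_
    have heS : e ∉ S := fun h => he (Finset.mem_powerset.1 hS h)
    rw [Finset.card_insert_of_notMem he, Finset.card_insert_of_notMem heS, Nat.add_sub_add_right,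
      pow_succ]
    ring

lemma bernSum_congr {p : ℝ} {E : Finset α} {F G : Finset α → ℝ} (h : ∀ S ⊆ E, F S = G S) :
    bernSum p E F = bernSum p E G :=
  Finset.sum_congr rfl fun S hS => by rw [h S (Finset.mem_powerset.1 hS)]

lemma bernSum_mono {p : ℝ} (hp0 : 0 ≤ p) (hp1 : p ≤ 1) {E : Finset α} {F G : Finset α → ℝ}
    (h : ∀ S ⊆ E, F S ≤ G S) : bernSum p E F ≤ bernSum p E G := by
  refine Finset.sum_le_sum fun S hS => mul_le_mul_of_nonneg_left (h S (Finset.mem_powerset.1 hS)) ?_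
  have : 0 ≤ 1 - p := by linarith
  positivity

lemma bernSum_nonneg {p : ℝ} (hp0 : 0 ≤ p) (hp1 : p ≤ 1) {E : Finset α} {F : Finset α → ℝ}
    (h : ∀ S ⊆ E, 0 ≤ F S) : 0 ≤ bernSum p E F := by
  have : 0 ≤ 1 - p := by linarith
  exact Finset.sum_nonneg fun S hS =>
    mul_nonneg (by positivity) (h S (Finset.mem_powerset.1 hS))

lemma bernSum_add (p : ℝ) (E : Finset α) (F G : Finset α → ℝ) :
    bernSum p E (fun S => F S + G S) = bernSum p E F + bernSum p E G := by
  simp only [bernSum, mul_add, Finset.sum_add_distrib]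

lemma bernSum_mul_left (p : ℝ) (E : Finset α) (c : ℝ) (F : Finset α → ℝ) :
    bernSum p E (fun S => c * F S) = c * bernSum p E F := by
  simp only [bernSum, Finset.mul_sum]
  exact Finset.sum_congr rfl fun S _ => by ring

lemma bernSum_sum {ι : Type*} (s : Finset ι) (p : ℝ) (E : Finset α) (F : ι → Finset α → ℝ) :
    bernSum p E (fun S => ∑ i ∈ s, F i S) = ∑ i ∈ s, bernSum p E (F i) := by
  simp only [bernSum, Finset.mul_sum]
  rw [Finset.sum_comm]

/-- **Finner's inequality** with exponents two: if each coordinate influences at most two of the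
nonnegative functions `F v`, then the expectation of their product is at most the product of their
`L²` norms. -/
lemma bernSum_prod_le_prod_sqrt [DecidableEq α] {V : Type*} [Fintype V] [DecidableEq V] {p : ℝ} (hp0 : 0 ≤ p)
    (hp1 : p ≤ 1) (E : Finset α) (u w : α → V) (huw : ∀ e ∈ E, u e ≠ w e)
    (F : V → Finset α → ℝ) (hF0 : ∀ v S, 0 ≤ F v S)
    (hF : ∀ e ∈ E, ∀ v, v ≠ u e → v ≠ w e → ∀ S, F v (insert e S) = F v S) :
    bernSum p E (fun S => ∏ v, F v S) ≤ ∏ v, √(bernSum p E (fun S => F v S ^ 2)) := by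
  induction E using Finset.induction_on generalizing F with
  | empty => simp [bernSum_empty, Real.sqrt_sq (hF0 _ _)]
  | insert e E he ih =>
    have hp' : 0 ≤ 1 - p := by linarith
    have hinv : ∀ e' ∈ E, ∀ v, v ≠ u e' → v ≠ w e' → ∀ S, F v (insert e' S) = F v S :=
      fun e' he' => hF e' (Finset.mem_insert_of_mem he')
    have huw' : ∀ e' ∈ E, u e' ≠ w e' := fun e' he' => huw e' (Finset.mem_insert_of_mem he')
    -- Conditioning on the coordinate e: the induction hypothesis is used for the functions without
    -- e (`h1`) and with e (`h2`).
    have h1 := ih huw' F hF0 hinv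
    have h2 := ih huw' (fun v S => F v (insert e S)) (fun v S => hF0 v _) (by
      intro e' he' v h h' S
      rw [Finset.insert_comm, hinv e' he' v h h'])
    rw [bernSum_insert p he]
    set A : V → ℝ := fun v => bernSum p E (fun S => F v S ^ 2) with hA
    set B : V → ℝ := fun v => bernSum p E (fun S => F v (insert e S) ^ 2) with hB
    have hA0 : ∀ v, 0 ≤ A v := fun v => bernSum_nonneg hp0 hp1 fun S _ => by positivity
    have hB0 : ∀ v, 0 ≤ B v := fun v => bernSum_nonneg hp0 hp1 fun S _ => by positivity
    have hC : ∀ v, bernSum p (insert e E) (fun S => F v S ^ 2) = (1 - p) * A v + p * B v := by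
      intro v; rw [bernSum_insert p he]
    simp only [hC]
    have hne : u e ≠ w e := huw e (Finset.mem_insert_self _ _)
    -- Only the two factors at the ends of e see this coordinate. The others have the same norm in
    -- both branches and come out as the common factor `Q`.
    have hAB : ∀ v, v ≠ u e → v ≠ w e → B v = A v := by
      intro v h h'
      refine bernSum_congr fun S _ => ?_
      rw [hF e (Finset.mem_insert_self _ _) v h h' S]
    have hsplit : ∀ f : V → ℝ, ∏ v, f v =
        f (u e) * f (w e) * ∏ v ∈ (Finset.univ.erase (u e)).erase (w e), f v := by
      intro f
      rw [← Finset.mul_prod_erase Finset.univ f (Finset.mem_univ (u e)),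
        ← Finset.mul_prod_erase (Finset.univ.erase (u e)) f
          (Finset.mem_erase.2 ⟨hne.symm, Finset.mem_univ (w e)⟩)]
      ring
    have hR1 : ∏ v ∈ (Finset.univ.erase (u e)).erase (w e), √(B v) =
        ∏ v ∈ (Finset.univ.erase (u e)).erase (w e), √(A v) := by
      refine Finset.prod_congr rfl fun v hv => ?_
      simp only [Finset.mem_erase, Finset.mem_univ, and_true] at hv
      rw [hAB v hv.2 hv.1]
    have hR2 : ∏ v ∈ (Finset.univ.erase (u e)).erase (w e), √((1 - p) * A v + p * B v) =
        ∏ v ∈ (Finset.univ.erase (u e)).erase (w e), √(A v) := by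
      refine Finset.prod_congr rfl fun v hv => ?_
      simp only [Finset.mem_erase, Finset.mem_univ, and_true] at hv
      rw [hAB v hv.2 hv.1]
      congr 1
      ring
    set Q := ∏ v ∈ (Finset.univ.erase (u e)).erase (w e), √(A v) with hQ
    have hQ0 : 0 ≤ Q := Finset.prod_nonneg fun v _ => Real.sqrt_nonneg _
    rw [hsplit, hQ.symm] at h1
    rw [hsplit] at h2
    change _ ≤ √(B (u e)) * √(B (w e)) * ∏ v ∈ (Finset.univ.erase (u e)).erase (w e), √(B v) at h2
    rw [hR1] at h2
    rw [hsplit, hR2]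
    -- Cauchy–Schwarz for the two-point measure with weights 1-p and p; after squaring, the
    -- difference of the two sides is p(1-p)(xt - yz)².
    have hcs : (1 - p) * (√(A (u e)) * √(A (w e))) + p * (√(B (u e)) * √(B (w e))) ≤
        √((1 - p) * A (u e) + p * B (u e)) * √((1 - p) * A (w e) + p * B (w e)) := by
      rw [← Real.sqrt_mul (add_nonneg (mul_nonneg hp' (hA0 _)) (mul_nonneg hp0 (hB0 _)))]
      refine Real.le_sqrt_of_sq_le ?_
      have e1 := Real.sq_sqrt (hA0 (u e))
      have e2 := Real.sq_sqrt (hA0 (w e))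
      have e3 := Real.sq_sqrt (hB0 (u e))
      have e4 := Real.sq_sqrt (hB0 (w e))
      set x := √(A (u e))
      set y := √(A (w e))
      set z := √(B (u e))
      set t := √(B (w e))
      rw [← e1, ← e2, ← e3, ← e4]
      nlinarith [mul_nonneg (mul_nonneg hp0 hp') (sq_nonneg (x * t - y * z))]
    calc _ ≤ (1 - p) * (√(A (u e)) * √(A (w e)) * Q) + p * (√(B (u e)) * √(B (w e)) * Q) :=
          add_le_add (mul_le_mul_of_nonneg_left h1 hp') (mul_le_mul_of_nonneg_left h2 hp0)
      _ = ((1 - p) * (√(A (u e)) * √(A (w e))) + p * (√(B (u e)) * √(B (w e)))) * Q := by ring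
      _ ≤ _ := mul_le_mul_of_nonneg_right hcs hQ0

end BernSum

/-! ### Expectations under a binomial distribution -/

/-- The expectation of `h` under the binomial distribution with parameters `m` and `p`. -/
noncomputable def binExp (p : ℝ) (m : ℕ) (h : ℕ → ℝ) : ℝ :=
  bernSum p (Finset.range m) (fun S => h S.card)

lemma binExp_zero (p : ℝ) (h : ℕ → ℝ) : binExp p 0 h = h 0 := by
  simp [binExp, bernSum_empty]

lemma binExp_succ (p : ℝ) (m : ℕ) (h : ℕ → ℝ) :
    binExp p (m + 1) h = (1 - p) * binExp p m h + p * binExp p m (fun k => h (k + 1)) := by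
  rw [binExp, Finset.range_add_one, bernSum_insert _ Finset.notMem_range_self]
  congr 2
  refine bernSum_congr fun S hS => ?_
  rw [Finset.card_insert_of_notMem fun h => Finset.notMem_range_self (hS h)]

lemma bernSum_card_filter {α : Type*} [DecidableEq α] (p : ℝ) (E : Finset α) (P : α → Prop)
    [DecidablePred P] (h : ℕ → ℝ) :
    bernSum p E (fun S => h (S.filter P).card) = binExp p (E.filter P).card h := by
  induction E using Finset.induction_on generalizing h with
  | empty => simp [bernSum_empty, binExp_zero]
  | insert e E he ih =>
    rw [bernSum_insert p he]
    by_cases hP : P e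
    · rw [Finset.filter_insert, if_pos hP, Finset.card_insert_of_notMem (by simp [he]),
        binExp_succ, ← ih, ← ih]
      congr 2
      refine bernSum_congr fun S hS => ?_
      rw [Finset.filter_insert, if_pos hP, Finset.card_insert_of_notMem]
      simp only [Finset.mem_filter, not_and]
      exact fun h => absurd (hS h) he
    · rw [Finset.filter_insert, if_neg hP, ← ih]
      have : bernSum p E (fun S => h ((insert e S).filter P).card) =
          bernSum p E (fun S => h (S.filter P).card) :=
        bernSum_congr fun S _ => by rw [Finset.filter_insert, if_neg hP]
      rw [this]
      ring

lemma binExp_eq_sum (p : ℝ) (m : ℕ) (h : ℕ → ℝ) :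
    binExp p m h = ∑ k ∈ Finset.range (m + 1), m.choose k * p ^ k * (1 - p) ^ (m - k) * h k := by
  rw [binExp, bernSum]
  simp only [Finset.card_range]
  rw [Finset.sum_powerset_apply_card (fun k => p ^ k * (1 - p) ^ (m - k) * h k)]
  simp [mul_assoc]

lemma binExp_mono {p : ℝ} (hp0 : 0 ≤ p) (hp1 : p ≤ 1) {m : ℕ} {F G : ℕ → ℝ}
    (h : ∀ k ≤ m, F k ≤ G k) : binExp p m F ≤ binExp p m G :=
  bernSum_mono hp0 hp1 fun S hS => h _ (by simpa using Finset.card_le_card hS)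

lemma binExp_congr {p : ℝ} {m : ℕ} {F G : ℕ → ℝ}
    (h : ∀ k ≤ m, F k = G k) : binExp p m F = binExp p m G :=
  bernSum_congr fun S hS => h _ (by simpa using Finset.card_le_card hS)

lemma binExp_add (p : ℝ) (m : ℕ) (F G : ℕ → ℝ) :
    binExp p m (fun k => F k + G k) = binExp p m F + binExp p m G :=
  bernSum_add _ _ _ _

lemma binExp_mul_left (p : ℝ) (m : ℕ) (c : ℝ) (F : ℕ → ℝ) :
    binExp p m (fun k => c * F k) = c * binExp p m F :=
  bernSum_mul_left _ _ _ _

lemma binExp_const (p : ℝ) (m : ℕ) (c : ℝ) : binExp p m (fun _ => c) = c := by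
  induction m with
  | zero => simp [binExp_zero]
  | succ m ih => rw [binExp_succ, ih]; ring

lemma binExp_choose (p : ℝ) (m r : ℕ) :
    binExp p m (fun k => (k.choose r : ℝ)) = m.choose r * p ^ r := by
  induction m generalizing r with
  | zero => cases r <;> simp [binExp_zero]
  | succ m ih =>
    cases r with
    | zero => simpa using binExp_const p (m + 1) 1
    | succ r =>
      rw [binExp_succ, ih]
      simp only [Nat.choose_succ_succ', Nat.cast_add, binExp_add, ih]
      ring

lemma binExp_pow (p : ℝ) (m : ℕ) (θ : ℝ) :
    binExp p m (fun k => θ ^ k) = (1 - p + p * θ) ^ m := by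
  induction m with
  | zero => simp [binExp_zero]
  | succ m ih =>
    rw [binExp_succ, ih]
    simp only [pow_succ, mul_comm _ θ, binExp_mul_left, ih]
    ring

lemma binExp_mul_le_sqrt_mul_sqrt {p : ℝ} (hp0 : 0 ≤ p) (hp1 : p ≤ 1) (m : ℕ) (F G : ℕ → ℝ) :
    binExp p m (fun k => F k * G k) ≤
      √(binExp p m (fun k => F k ^ 2)) * √(binExp p m (fun k => G k ^ 2)) := by
  have hp' : 0 ≤ 1 - p := by linarith
  have hw : ∀ S : Finset ℕ, 0 ≤ p ^ S.card * (1 - p) ^ ((Finset.range m).card - S.card) :=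
    fun S => by positivity
  have h := Real.sum_mul_le_sqrt_mul_sqrt (Finset.range m).powerset
    (fun S => √(p ^ S.card * (1 - p) ^ ((Finset.range m).card - S.card)) * F S.card)
    (fun S => √(p ^ S.card * (1 - p) ^ ((Finset.range m).card - S.card)) * G S.card)
  simp only [mul_pow, Real.sq_sqrt (hw _)] at h
  unfold binExp bernSum
  refine le_trans (le_of_eq ?_) h
  refine Finset.sum_congr rfl fun S _ => ?_
  have := Real.mul_self_sqrt (hw S)
  linear_combination (-(F S.card * G S.card)) * this

/-! ### From the random graph to a single degree -/

lemma integral_binomialRandom {V : Type*} [Fintype V] [DecidableEq V] (p : unitInterval)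
    (h : SimpleGraph V → ℝ) :
    ∫ G, h G ∂(binomialRandom V p) =
      bernSum (p : ℝ) (⊤ : SimpleGraph V).edgeFinset (fun S => h (fromEdgeSet (S : Set (Sym2 V)))) := by
  classical
  rw [integral_fintype .of_finite, bernSum]
  refine Finset.sum_bij' (fun G _ => G.edgeFinset) (fun S _ => fromEdgeSet (S : Set (Sym2 V)))
    ?_ ?_ ?_ ?_ ?_
  · intro G _
    rw [Finset.mem_powerset]
    exact edgeFinset_mono le_top
  · simp
  · intro G _
    simp
  · intro S hS
    rw [Finset.mem_powerset] at hS
    have hd : ∀ e ∈ S, ¬ e.IsDiag := fun e he => by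
      have := hS he
      simpa using this
    ext e
    simp only [mem_edgeFinset, edgeSet_fromEdgeSet, Set.mem_sdiff, Finset.mem_coe]
    exact ⟨fun h => h.1, fun h => ⟨h, hd e h⟩⟩
  · intro G _
    have h1 : G.edgeSet.ncard = G.edgeFinset.card := by
      rw [← coe_edgeFinset, Set.ncard_coe_finset]
    rw [measureReal_def, binomialRandom_singleton, h1, card_edgeFinset_top_eq_card_choose_two]
    simp

lemma measureReal_binomialRandom {V : Type*} [Fintype V] [DecidableEq V] (p : unitInterval)
    (P : SimpleGraph V → Prop) [DecidablePred P] :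
    (binomialRandom V p).real {G | P G} =
      bernSum (p : ℝ) (⊤ : SimpleGraph V).edgeFinset
        (fun S => if P (fromEdgeSet (S : Set (Sym2 V))) then 1 else 0) := by
  rw [← integral_binomialRandom p (fun G => if P G then (1 : ℝ) else 0),
    ← integral_indicator_one (Set.toFinite _).measurableSet]
  congr 1
  ext G
  simp [Set.indicator_apply]

lemma degree_fromEdgeSet {V : Type*} [Fintype V] [DecidableEq V] {S : Finset (Sym2 V)}
    (hS : S ⊆ (⊤ : SimpleGraph V).edgeFinset) (v : V)
    [DecidableRel (fromEdgeSet (S : Set (Sym2 V))).Adj] :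
    (fromEdgeSet (S : Set (Sym2 V))).degree v = (S.filter (v ∈ ·)).card := by
  rw [← card_incidenceFinset_eq_degree, incidenceFinset_eq_filter]
  congr 1
  ext e
  simp only [Finset.mem_filter, mem_edgeFinset, edgeSet_fromEdgeSet, Set.mem_sdiff, Finset.mem_coe]
  constructor
  · exact fun h => ⟨h.1.1, h.2⟩
  · intro h
    have := hS h.1
    exact ⟨⟨h.1, by simpa using this⟩, h.2⟩

lemma card_filter_mem_edgeFinset_top (n : ℕ) (v : Fin n) :
    ((⊤ : SimpleGraph (Fin n)).edgeFinset.filter (v ∈ ·)).card = n - 1 := by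
  rw [← incidenceFinset_eq_filter, card_incidenceFinset_eq_degree]
  simp

lemma starCount_fromEdgeSet {r n : ℕ} (hr : 2 ≤ r) {S : Finset (Sym2 (Fin n))}
    (hS : S ⊆ (⊤ : SimpleGraph (Fin n)).edgeFinset) :
    starCount r (fromEdgeSet (S : Set (Sym2 (Fin n)))) =
      ∑ v, (S.filter (v ∈ ·)).card.choose r := by
  classical
  rw [starCount_eq_sum_choose_degree hr]
  exact Finset.sum_congr rfl fun v _ => by rw [degree_fromEdgeSet hS]

lemma starMean_eq {r : ℕ} (hr : 2 ≤ r) (n : ℕ) (p : unitInterval) :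
    starMean r n p = n * ((n - 1).choose r * (p : ℝ) ^ r) := by
  rw [starMean, integral_binomialRandom]
  have h : bernSum (p : ℝ) (⊤ : SimpleGraph (Fin n)).edgeFinset
      (fun S => (starCount r (fromEdgeSet (S : Set (Sym2 (Fin n)))) : ℝ)) =
      bernSum (p : ℝ) (⊤ : SimpleGraph (Fin n)).edgeFinset
      (fun S => ∑ v, ((S.filter (v ∈ ·)).card.choose r : ℝ)) :=
    bernSum_congr fun S hS => by rw [starCount_fromEdgeSet hr hS]; push_cast; rfl
  rw [h, bernSum_sum]
  have : ∀ v : Fin n, bernSum (p : ℝ) (⊤ : SimpleGraph (Fin n)).edgeFinset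
      (fun S => ((S.filter (v ∈ ·)).card.choose r : ℝ)) = (n - 1).choose r * (p : ℝ) ^ r := by
    intro v
    rw [bernSum_card_filter (p : ℝ) _ (v ∈ ·) (fun k => (k.choose r : ℝ)),
      card_filter_mem_edgeFinset_top, binExp_choose]
  simp only [this, Finset.sum_const, Finset.card_univ, Fintype.card_fin, nsmul_eq_mul]

/-- The moment generating function of a sum over the vertices of a function of the degree is
controlled by that of a single binomial variable. -/
lemma bernSum_exp_sum_degree_le (n : ℕ) (p : unitInterval) (g : ℕ → ℝ) {Y : ℝ}
    (hY : binExp (p : ℝ) (n - 1) (fun d => Real.exp (2 * g d)) ≤ Real.exp Y) :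
    bernSum (p : ℝ) (⊤ : SimpleGraph (Fin n)).edgeFinset
      (fun S => Real.exp (∑ v, g (S.filter (v ∈ ·)).card)) ≤ Real.exp (n * Y / 2) := by
  have hout : ∀ e : Sym2 (Fin n), s((Quot.out e).1, (Quot.out e).2) = e := fun e => Quot.out_eq e
  have hF := bernSum_prod_le_prod_sqrt (V := Fin n) p.2.1 p.2.2
    (⊤ : SimpleGraph (Fin n)).edgeFinset (fun e => (Quot.out e).1) (fun e => (Quot.out e).2)
    (by
      intro e he heq
      have he' : ¬ e.IsDiag := by simpa using he
      apply he'
      rw [← hout e, Sym2.mk_isDiag_iff]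
      exact heq)
    (fun v S => Real.exp (g (S.filter (v ∈ ·)).card)) (fun v S => (Real.exp_pos _).le)
    (by
      intro e _ v h1 h2 S
      have : v ∉ e := by
        rw [← hout e, Sym2.mem_iff]
        tauto
      simp only [Finset.filter_insert, if_neg this])
  simp only [Real.exp_sum]
  refine hF.trans ?_
  have : ∀ v : Fin n, bernSum (p : ℝ) (⊤ : SimpleGraph (Fin n)).edgeFinset
      (fun S => Real.exp (g (S.filter (v ∈ ·)).card) ^ 2) ≤ Real.exp Y := by
    intro v
    rw [bernSum_card_filter (p : ℝ) _ (v ∈ ·) (fun k => Real.exp (g k) ^ 2),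
      card_filter_mem_edgeFinset_top]
    refine le_trans (le_of_eq ?_) hY
    refine binExp_congr fun k _ => ?_
    rw [← Real.exp_nat_mul]; simp
  -- Finner's inequality produces n square roots of second moments; this is the origin of 2g in the
  -- hypothesis and of the factor 1/2 in the conclusion.
  calc _ ≤ ∏ _v : Fin n, √(Real.exp Y) :=
        Finset.prod_le_prod (fun v _ => Real.sqrt_nonneg _) fun v _ => Real.sqrt_le_sqrt (this v)
    _ = Real.exp (n * Y / 2) := by
        rw [Finset.prod_const, ← Real.exp_half, ← Real.exp_nat_mul]
        simp; ring

/-- If some degree exceeds K, the union bound applies. Otherwise truncation changes nothing, the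
truncated sum equals X, and the indicator of X ≥ x is at most exp(λ(X - x)). -/
lemma starUpperTail_le {r : ℕ} (hr : 2 ≤ r) (n : ℕ) (p : unitInterval) (x K : ℝ) {lam Y : ℝ}
    (hlam : 0 ≤ lam)
    (hY : binExp (p : ℝ) (n - 1)
      (fun d => Real.exp (2 * (lam * if (d : ℝ) ≤ K then (d.choose r : ℝ) else 0))) ≤ Real.exp Y) :
    starUpperTail r n p x ≤
      n * binExp (p : ℝ) (n - 1) (fun d => if K < (d : ℝ) then 1 else 0) +
        Real.exp (n * Y / 2 - lam * x) := by
  classical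
  rw [starUpperTail, measureReal_binomialRandom]
  set f : ℕ → ℝ := fun d => if (d : ℝ) ≤ K then (d.choose r : ℝ) else 0 with hf
  have hpt : ∀ S ⊆ (⊤ : SimpleGraph (Fin n)).edgeFinset,
      (if x ≤ (starCount r (fromEdgeSet (S : Set (Sym2 (Fin n)))) : ℝ) then (1 : ℝ) else 0) ≤
        (∑ v, if K < ((S.filter (v ∈ ·)).card : ℝ) then (1 : ℝ) else 0) +
          Real.exp (-(lam * x)) * Real.exp (∑ v, lam * f (S.filter (v ∈ ·)).card) := by
    intro S hS
    have hpos : (0 : ℝ) ≤ ∑ v : Fin n, if K < ((S.filter (v ∈ ·)).card : ℝ) then (1 : ℝ) else 0 :=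
      Finset.sum_nonneg fun v _ => by split_ifs <;> norm_num
    have hexp : 0 ≤ Real.exp (-(lam * x)) * Real.exp (∑ v, lam * f (S.filter (v ∈ ·)).card) := by
      positivity
    split_ifs with hx
    · by_cases hK : ∃ v : Fin n, K < ((S.filter (v ∈ ·)).card : ℝ)
      · obtain ⟨v, hv⟩ := hK
        have : (1 : ℝ) ≤ ∑ v : Fin n, if K < ((S.filter (v ∈ ·)).card : ℝ) then (1 : ℝ) else 0 := by
          refine le_trans (by simp [hv]) (Finset.single_le_sum
            (f := fun v : Fin n => if K < ((S.filter (v ∈ ·)).card : ℝ) then (1 : ℝ) else 0)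
            (fun w _ => by split_ifs <;> norm_num) (Finset.mem_univ v))
        linarith
      · push Not at hK
        rw [starCount_fromEdgeSet hr hS] at hx
        have h2 : ∑ v, lam * f (S.filter (v ∈ ·)).card =
            lam * ∑ v : Fin n, ((S.filter (v ∈ ·)).card.choose r : ℝ) := by
          rw [Finset.mul_sum]
          exact Finset.sum_congr rfl fun v _ => by simp only [hf, if_pos (hK v)]
        have h3 : 1 ≤ Real.exp (-(lam * x)) *
            Real.exp (∑ v, lam * f (S.filter (v ∈ ·)).card) := by
          rw [← Real.exp_add, h2]
          refine Real.one_le_exp ?_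
          push_cast at hx
          have := mul_le_mul_of_nonneg_left hx hlam
          linarith
        linarith
    · linarith
  refine (bernSum_mono p.2.1 p.2.2 hpt).trans ?_
  rw [bernSum_add, bernSum_sum, bernSum_mul_left]
  refine add_le_add (le_of_eq ?_) ?_
  · have : ∀ v : Fin n, bernSum (p : ℝ) (⊤ : SimpleGraph (Fin n)).edgeFinset
        (fun S => if K < ((S.filter (v ∈ ·)).card : ℝ) then (1 : ℝ) else 0) =
        binExp (p : ℝ) (n - 1) (fun d => if K < (d : ℝ) then 1 else 0) := by
      intro v
      rw [bernSum_card_filter (p : ℝ) _ (v ∈ ·) (fun k => if K < (k : ℝ) then (1 : ℝ) else 0),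
        card_filter_mem_edgeFinset_top]
    simp only [this, Finset.sum_const, Finset.card_univ, Fintype.card_fin, nsmul_eq_mul]
  · have h := bernSum_exp_sum_degree_le n p (fun d => lam * f d) hY
    calc _ ≤ Real.exp (-(lam * x)) * Real.exp (n * Y / 2) :=
          mul_le_mul_of_nonneg_left h (Real.exp_pos _).le
      _ = _ := by rw [← Real.exp_add]; ring_nf

/-! ### Exponential inequalities, binomial masses and tails -/

/-- The factor exp y in the quadratic term makes the second-order expansion valid for every y ≥ 0,
so it can be integrated without first knowing that y is small. -/
lemma exp_le_one_add_add_sq_mul_exp {y : ℝ} (hy : 0 ≤ y) :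
    Real.exp y ≤ 1 + y + y ^ 2 * Real.exp y := by
  have h1 : Real.exp y - 1 ≤ y * Real.exp y := by
    have := Real.add_one_le_exp (-y)
    have h2 := mul_le_mul_of_nonneg_right this (Real.exp_pos y).le
    rw [← Real.exp_add] at h2
    simp at h2
    linarith
  nlinarith

lemma pow_le_factorial_mul_exp {y : ℝ} (hy : 0 ≤ y) (k : ℕ) :
    y ^ k ≤ k.factorial * Real.exp y := by
  have := Real.pow_div_factorial_le_exp y hy k
  rw [div_le_iff₀ (by positivity)] at this
  linarith

lemma sum_range_exp_neg_div_two_le (N : ℕ) :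
    ∑ d ∈ Finset.range N, Real.exp (-((d : ℝ) / 2)) ≤ 3 := by
  have h1 : ∀ d : ℕ, Real.exp (-((d : ℝ) / 2)) = Real.exp (-(1 / 2)) ^ d := by
    intro d; rw [← Real.exp_nat_mul]; ring_nf
  have hq0 : 0 ≤ Real.exp (-(1 / 2)) := (Real.exp_pos _).le
  have hq1 : Real.exp (-(1 / 2)) ≤ 2 / 3 := by
    rw [Real.exp_neg, inv_le_comm₀ (Real.exp_pos _) (by norm_num)]
    have := Real.add_one_le_exp (1 / 2 : ℝ)
    norm_num at this ⊢; linarith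
  simp only [h1]
  calc _ ≤ ∑' d : ℕ, Real.exp (-(1 / 2)) ^ d :=
        Summable.sum_le_tsum _ (fun d _ => by positivity)
          (summable_geometric_of_lt_one hq0 (by linarith))
    _ = (1 - Real.exp (-(1 / 2)))⁻¹ := tsum_geometric_of_lt_one hq0 (by linarith)
    _ ≤ 3 := by
        rw [inv_le_comm₀ (by linarith) (by norm_num)]
        linarith

section Binomial

variable {p : ℝ} {m : ℕ}

lemma binExp_le_sum {h : ℕ → ℝ} {g : ℕ → ℝ}
    (hg : ∀ d ≤ m, m.choose d * p ^ d * (1 - p) ^ (m - d) * h d ≤ g d) :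
    binExp p m h ≤ ∑ d ∈ Finset.range (m + 1), g d := by
  rw [binExp_eq_sum]
  exact Finset.sum_le_sum fun d hd => hg d (Nat.lt_succ_iff.1 (Finset.mem_range.1 hd))

lemma binomial_mass_nonneg (hp0 : 0 ≤ p) (hp1 : p ≤ 1) (d : ℕ) :
    0 ≤ m.choose d * p ^ d * (1 - p) ^ (m - d) := by
  have : 0 ≤ 1 - p := by linarith
  positivity

lemma binomial_mass_le_pow_div_factorial (hp0 : 0 ≤ p) (hp1 : p ≤ 1) {a : ℝ} (ha : m * p ≤ a)
    (d : ℕ) : m.choose d * p ^ d * (1 - p) ^ (m - d) ≤ a ^ d / d.factorial := by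
  have hp' : 0 ≤ 1 - p := by linarith
  have h1 : (1 - p) ^ (m - d) ≤ 1 := pow_le_one₀ hp' (by linarith)
  have h2 : (m.choose d : ℝ) ≤ (m : ℝ) ^ d / d.factorial := Nat.choose_le_pow_div d m
  calc _ ≤ (m : ℝ) ^ d / d.factorial * p ^ d * 1 := by gcongr
    _ = (m * p) ^ d / d.factorial := by rw [mul_pow]; ring
    _ ≤ _ := by gcongr

lemma binExp_exp_le (hp0 : 0 ≤ p) (hp1 : p ≤ 1) {θ : ℝ} (hθ : |θ| ≤ 1) :
    binExp p m (fun d => Real.exp (θ * (d - m * p))) ≤ Real.exp (m * p * θ ^ 2) := by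
  have h1 : binExp p m (fun d => Real.exp (θ * (d - m * p))) =
      Real.exp (-(θ * (m * p))) * (1 - p + p * Real.exp θ) ^ m := by
    rw [← binExp_pow, ← binExp_mul_left]
    refine binExp_congr fun d _ => ?_
    rw [← Real.exp_nat_mul, ← Real.exp_add]
    ring_nf
  have h2 : 1 - p + p * Real.exp θ ≤ Real.exp (p * (Real.exp θ - 1)) := by
    have := Real.add_one_le_exp (p * (Real.exp θ - 1))
    linarith
  have h3 : 0 ≤ 1 - p + p * Real.exp θ := by
    have := mul_nonneg hp0 (Real.exp_pos θ).le
    linarith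
  have h4 := (abs_le.1 (Real.abs_exp_sub_one_sub_id_le hθ)).2
  rw [h1]
  calc _ ≤ Real.exp (-(θ * (m * p))) * Real.exp (p * (Real.exp θ - 1)) ^ m := by gcongr
    _ = Real.exp (m * p * (Real.exp θ - 1 - θ)) := by
        rw [← Real.exp_nat_mul, ← Real.exp_add]; ring_nf
    _ ≤ _ := by gcongr

/-- A single term of the moment generating function is at most the whole sum. The parameter θ is
free, and a choice proportional to d - mp gives Gaussian decay. -/
lemma binomial_mass_le_exp (hp0 : 0 ≤ p) (hp1 : p ≤ 1) {θ : ℝ} (hθ : |θ| ≤ 1) {d : ℕ}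
    (hd : d ≤ m) : m.choose d * p ^ d * (1 - p) ^ (m - d) ≤
      Real.exp (-(θ * (d - m * p)) + m * p * θ ^ 2) := by
  have h := binExp_exp_le (m := m) hp0 hp1 hθ
  rw [binExp_eq_sum] at h
  have h2 := (Finset.single_le_sum
    (f := fun k : ℕ => m.choose k * p ^ k * (1 - p) ^ (m - k) * Real.exp (θ * (k - m * p)))
    (fun k _ => mul_nonneg (binomial_mass_nonneg hp0 hp1 k) (Real.exp_pos _).le)
    (Finset.mem_range.2 (Nat.lt_succ_iff.2 hd))).trans h
  rw [Real.exp_add, Real.exp_neg, inv_mul_eq_div, le_div_iff₀ (Real.exp_pos _)]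
  exact h2

/-- Chernoff's bound with tilt K/h, where h need only dominate the mean; this allows h = max(np, 1)
when np is small. -/
lemma binExp_tail_le (hp0 : 0 ≤ p) (hp1 : p ≤ 1) {h K : ℝ} (hh : 0 < h) (hmh : m * p ≤ h)
    (hK : h ≤ K) :
    binExp p m (fun d => if K < (d : ℝ) then 1 else 0) ≤
      Real.exp (-(K * (Real.log (K / h) - 1))) := by
  have hK0 : 0 < K := hh.trans_le hK
  have hlog : 0 ≤ Real.log (K / h) := Real.log_nonneg ((one_le_div hh).2 hK)
  have h1 : binExp p m (fun d => if K < (d : ℝ) then 1 else 0) ≤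
      Real.exp (-(K * Real.log (K / h))) * (1 - p + p * (K / h)) ^ m := by
    rw [← binExp_pow, ← binExp_mul_left]
    refine binExp_mono hp0 hp1 fun d _ => ?_
    have : (K / h) ^ d = Real.exp (d * Real.log (K / h)) := by
      rw [Real.exp_nat_mul, Real.exp_log (by positivity)]
    rw [this, ← Real.exp_add]
    split_ifs with hd
    · refine Real.one_le_exp ?_
      nlinarith
    · positivity
  have h2 : (1 - p + p * (K / h)) ^ m ≤ Real.exp K := by
    have e1 : 1 - p + p * (K / h) ≤ Real.exp (p * (K / h)) := by
      have := Real.add_one_le_exp (p * (K / h))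
      linarith
    calc _ ≤ Real.exp (p * (K / h)) ^ m := by
          have : 0 ≤ 1 - p + p * (K / h) := by
            have : 0 ≤ p * (K / h) := by positivity
            linarith
          gcongr
      _ = Real.exp (m * p * (K / h)) := by rw [← Real.exp_nat_mul]; ring_nf
      _ ≤ Real.exp K := by
          gcongr
          calc m * p * (K / h) ≤ h * (K / h) := by gcongr
            _ = K := by field_simp
  calc _ ≤ Real.exp (-(K * Real.log (K / h))) * Real.exp K := by
        refine h1.trans (by gcongr)
    _ = _ := by rw [← Real.exp_add]; ring_nf

/-- The second-order expansion is integrated and then 1 + y ≤ exp y is applied. The problem is thus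
reduced to the weighted second moment E g² exp(λg). -/
lemma binExp_exp_two_mul_le (hp0 : 0 ≤ p) (hp1 : p ≤ 1) {g : ℕ → ℝ} {lam : ℝ} (hlam : 0 ≤ lam)
    (hg : ∀ d, 0 ≤ g d) :
    binExp p m (fun d => Real.exp (lam * g d)) ≤
      Real.exp (lam * binExp p m g +
        lam ^ 2 * binExp p m (fun d => g d ^ 2 * Real.exp (lam * g d))) := by
  have h1 : binExp p m (fun d => Real.exp (lam * g d)) ≤
      binExp p m (fun d => 1 + (lam * g d + lam ^ 2 * (g d ^ 2 * Real.exp (lam * g d)))) := by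
    refine binExp_mono hp0 hp1 fun d _ => ?_
    have := exp_le_one_add_add_sq_mul_exp (mul_nonneg hlam (hg d))
    rw [mul_pow] at this
    linarith
  rw [binExp_add, binExp_const, binExp_add, binExp_mul_left, binExp_mul_left] at h1
  have := Real.add_one_le_exp (lam * binExp p m g +
        lam ^ 2 * binExp p m (fun d => g d ^ 2 * Real.exp (lam * g d)))
  linarith

end Binomial

/-! ### Weighted second moment in the sparse range -/

lemma self_pow_le_exp_mul_factorial (d : ℕ) : (d : ℝ) ^ d ≤ d.factorial * Real.exp d :=
  pow_le_factorial_mul_exp (Nat.cast_nonneg d) d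

/-- By d! ≥ (d/e)^d, the factor d^{d/2} uses up about half of the factorial, and the remaining √(d!)
beats any exponential and any power of d. -/
lemma exists_pow_mul_exp_div_factorial_le (r : ℕ) : ∃ C : ℝ, 0 < C ∧ ∀ d : ℕ, 1 ≤ d →
    (d : ℝ) ^ (2 * r) * Real.exp (d * Real.log d / 2) / d.factorial ≤
      C * Real.exp (-((d : ℝ) / 2)) := by
  refine ⟨√((4 * r).factorial * Real.exp (Real.exp 3)), by positivity, fun d hd => ?_⟩
  have hd0 : (0 : ℝ) < d := by exact_mod_cast hd
  have hf : (0 : ℝ) < d.factorial := by positivity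
  refine le_of_sq_le_sq ?_ (by positivity)
  have e1 : Real.exp (d * Real.log d / 2) ^ 2 = (d : ℝ) ^ d := by
    rw [← Real.exp_nat_mul]
    have : ((2 : ℕ) : ℝ) * (d * Real.log d / 2) = d * Real.log d := by push_cast; ring
    rw [this, Real.exp_nat_mul, Real.exp_log hd0]
  have e2 : Real.exp (-((d : ℝ) / 2)) ^ 2 = Real.exp (-d) := by
    rw [← Real.exp_nat_mul]; push_cast; ring_nf
  rw [div_pow, mul_pow, mul_pow, e1, e2, Real.sq_sqrt (by positivity), div_le_iff₀ (by positivity)]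
  have h1 := pow_le_factorial_mul_exp hd0.le (4 * r)
  have h2 := self_pow_le_exp_mul_factorial d
  have h3 := pow_le_factorial_mul_exp (Real.exp_pos 3).le d
  rw [← Real.exp_nat_mul] at h3
  have e3 : ((d : ℝ) ^ (2 * r)) ^ 2 = (d : ℝ) ^ (4 * r) := by rw [← pow_mul]; ring_nf
  have e4 : Real.exp d * Real.exp d = Real.exp (-d) * Real.exp (d * 3) := by
    rw [← Real.exp_add, ← Real.exp_add]; ring_nf
  rw [e3]
  calc (d : ℝ) ^ (4 * r) * (d : ℝ) ^ d
      ≤ ((4 * r).factorial * Real.exp d) * (d.factorial * Real.exp d) := by gcongr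
    _ = (4 * r).factorial * d.factorial * (Real.exp d * Real.exp d) := by ring
    _ = (4 * r).factorial * d.factorial * (Real.exp (-d) * Real.exp (d * 3)) := by rw [e4]
    _ ≤ (4 * r).factorial * d.factorial *
        (Real.exp (-d) * (d.factorial * Real.exp (Real.exp 3))) := by gcongr
    _ = _ := by ring

/-- In the sparse range, the exponential second moment of the truncated binomial coefficient
of a binomial variable of mean at most `a ≤ 1` is of order `a ^ r`. -/
lemma exists_binExp_choose_sq_mul_exp_le (r : ℕ) (hr : 2 ≤ r) : ∃ C : ℝ, 0 < C ∧
    ∀ (p : ℝ) (m : ℕ) (a K lam : ℝ), 0 ≤ p → p ≤ 1 → 0 < a → a ≤ 1 → m * p ≤ a → 0 ≤ lam →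
      (∀ d : ℕ, 3 ≤ d → (d : ℝ) ≤ K → d ≤ m →
        lam * (d : ℝ) ^ (r - 1) ≤ 1 / (4 * (r + 1)) * Real.log (d / a)) →
      binExp p m (fun d => (if (d : ℝ) ≤ K then (d.choose r : ℝ) else 0) ^ 2 *
        Real.exp (2 * lam * if (d : ℝ) ≤ K then (d.choose r : ℝ) else 0)) ≤
        C * a ^ r * Real.exp (2 * lam) := by
  obtain ⟨C, hC, hCd⟩ := exists_pow_mul_exp_div_factorial_le r
  refine ⟨1 + C * 3, by positivity, ?_⟩
  intro p m a K lam hp0 hp1 ha0 ha1 hma hlam hR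
  have hE1 : 1 ≤ Real.exp (2 * lam) := Real.one_le_exp (by positivity)
  have key : ∀ d ≤ m, m.choose d * p ^ d * (1 - p) ^ (m - d) *
      ((if (d : ℝ) ≤ K then (d.choose r : ℝ) else 0) ^ 2 *
        Real.exp (2 * lam * if (d : ℝ) ≤ K then (d.choose r : ℝ) else 0)) ≤
      (if d = r then a ^ r * Real.exp (2 * lam) else 0) +
        C * a ^ r * Real.exp (2 * lam) * Real.exp (-((d : ℝ) / 2)) := by
    intro d hd
    have hw := binomial_mass_le_pow_div_factorial hp0 hp1 hma d
    have hw0 := binomial_mass_nonneg (m := m) hp0 hp1 d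
    have hrhs : 0 ≤ C * a ^ r * Real.exp (2 * lam) * Real.exp (-((d : ℝ) / 2)) := by positivity
    have hrhs' : 0 ≤ (if d = r then a ^ r * Real.exp (2 * lam) else 0) := by
      split_ifs <;> positivity
    split_ifs with hdK hdr hdr
    · subst hdr
      simp only [Nat.choose_self, Nat.cast_one, one_pow, one_mul, mul_one]
      have : a ^ d / d.factorial ≤ a ^ d :=
        div_le_self (by positivity) (by exact_mod_cast Nat.one_le_iff_ne_zero.2 (Nat.factorial_ne_zero d))
      have h2 := mul_le_mul_of_nonneg_right (hw.trans this) (Real.exp_pos (2 * lam)).le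
      linarith
    · rcases lt_or_gt_of_ne hdr with hlt | hgt
      · simp [Nat.choose_eq_zero_of_lt hlt]
        positivity
      · have hd1 : 1 ≤ d := by omega
        have hd0 : (0 : ℝ) < d := by exact_mod_cast hd1
        have hch : (d.choose r : ℝ) ≤ (d : ℝ) ^ r := by exact_mod_cast Nat.choose_le_pow d r
        have hRd := hR d (by omega) hdK hd
        have hlog : Real.log (d / a) = Real.log d + Real.log (1 / a) := by
          rw [Real.log_div hd0.ne' ha0.ne', Real.log_div one_ne_zero ha0.ne', Real.log_one]; ring
        have hla : 0 ≤ Real.log (1 / a) := Real.log_nonneg ((one_le_div ha0).2 ha1)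
        have hld : 0 ≤ Real.log d := Real.log_nonneg (by exact_mod_cast hd1)
        have hr0 : (2 : ℝ) ≤ r := by exact_mod_cast hr
        have hdr' : (r : ℝ) + 1 ≤ d := by exact_mod_cast hgt
        -- The growth hypothesis bounds the left side by d/(2(r+1)) · log(d/a). For d ≥ r+1 this
        -- coefficient is at most d/2 and at most d-r: the log d part costs d^{d/2}, half of the
        -- factorial, and the log(1/a) part costs a^{-(d-r)}, which leaves a^r out of a^d.
        have hexp : 2 * lam * (d.choose r : ℝ) ≤
            d * Real.log d / 2 + (d - r : ℝ) * Real.log (1 / a) := by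
          have s1 : 2 * lam * (d.choose r : ℝ) ≤ 2 * d * (lam * (d : ℝ) ^ (r - 1)) := by
            have : (d : ℝ) ^ r = d * (d : ℝ) ^ (r - 1) := by
              rw [← pow_succ']; congr 1; omega
            calc _ ≤ 2 * lam * (d : ℝ) ^ r := by gcongr
              _ = _ := by rw [this]; ring
          have s2 : 2 * d * (lam * (d : ℝ) ^ (r - 1)) ≤
              2 * d * (1 / (4 * (r + 1)) * Real.log (d / a)) := by gcongr
          have s3 : 2 * d * (1 / (4 * (r + 1)) * Real.log (d / a)) =
              (d / (2 * (r + 1))) * Real.log d + (d / (2 * (r + 1))) * Real.log (1 / a) := by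
            rw [hlog]; field_simp; ring
          have s4 : (d : ℝ) / (2 * (r + 1)) ≤ d / 2 := by
            gcongr; linarith
          have s5 : (d : ℝ) / (2 * (r + 1)) ≤ d - r := by
            rw [div_le_iff₀ (by linarith)]
            nlinarith
          have s6 := mul_le_mul_of_nonneg_right s4 hld
          have s7 := mul_le_mul_of_nonneg_right s5 hla
          linarith
        have hpow : a ^ d * Real.exp ((d - r : ℝ) * Real.log (1 / a)) = a ^ r := by
          have : Real.exp ((d - r : ℝ) * Real.log (1 / a)) = (1 / a) ^ (d - r) := by
            rw [← Nat.cast_sub (by omega), Real.exp_nat_mul, Real.exp_log (by positivity)]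
          have e1 : a ^ d = a ^ r * a ^ (d - r) := by
            rw [← pow_add, Nat.add_sub_cancel' hgt.le]
          rw [this, e1, mul_assoc, ← mul_pow, mul_one_div_cancel ha0.ne', one_pow, mul_one]
        calc _ ≤ a ^ d / d.factorial * (((d : ℝ) ^ r) ^ 2 *
              Real.exp (d * Real.log d / 2 + (d - r : ℝ) * Real.log (1 / a))) := by gcongr
          _ = (a ^ d * Real.exp ((d - r : ℝ) * Real.log (1 / a))) *
              ((d : ℝ) ^ (2 * r) * Real.exp (d * Real.log d / 2) / d.factorial) := by
            rw [Real.exp_add, ← pow_mul, mul_comm r 2]; ring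
          _ ≤ a ^ r * (C * Real.exp (-((d : ℝ) / 2))) := by
            rw [hpow]; gcongr; exact hCd d hd1
          _ ≤ _ := by
            have h0 : 0 ≤ a ^ r * (C * Real.exp (-((d : ℝ) / 2))) := by positivity
            have := mul_le_mul_of_nonneg_left hE1 h0
            linarith
    all_goals
      simp
      positivity
  refine (binExp_le_sum key).trans ?_
  rw [Finset.sum_add_distrib, ← Finset.mul_sum]
  have h1 : ∑ d ∈ Finset.range (m + 1), (if d = r then a ^ r * Real.exp (2 * lam) else 0) ≤
      a ^ r * Real.exp (2 * lam) := by
    rw [Finset.sum_ite_eq']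
    split_ifs
    · exact le_rfl
    · positivity
  have h2 := mul_le_mul_of_nonneg_left (sum_range_exp_neg_div_two_le (m + 1))
    (by positivity : 0 ≤ C * a ^ r * Real.exp (2 * lam))
  linarith

/-! ### Tangent-line remainder and its second moment in the dense range -/

/-- The remainder in the first order discrete Taylor expansion of `d ↦ d.choose (s + 1)`
at `k`. -/
noncomputable def chooseRemainder (s k d : ℕ) : ℝ :=
  (d.choose (s + 1) : ℝ) - k.choose (s + 1) - k.choose s * (d - k)

lemma choose_sub_choose_le (s : ℕ) (k j : ℕ) :
    ((k + j).choose (s + 1) : ℝ) - k.choose (s + 1) ≤ j * (k + j : ℕ) ^ s := by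
  induction j with
  | zero => simp
  | succ j ih =>
    have h1 : ((k + (j + 1)).choose (s + 1) : ℝ) = (k + j).choose s + (k + j).choose (s + 1) := by
      rw [← add_assoc, Nat.choose_succ_succ']; push_cast; ring
    have h2 : ((k + j).choose s : ℝ) ≤ (k + (j + 1) : ℕ) ^ s := by
      calc ((k + j).choose s : ℝ) ≤ ((k + j : ℕ) : ℝ) ^ s := by exact_mod_cast Nat.choose_le_pow _ _
        _ ≤ _ := by gcongr; omega
    have h3 : (j : ℝ) * ((k + j : ℕ) : ℝ) ^ s ≤ j * ((k + (j + 1) : ℕ) : ℝ) ^ s := by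
      gcongr; omega
    rw [h1]; push_cast at *
    linarith

/-- Discrete convexity. By Pascal's rule the remainder increases from d to d+1 by C(d, s+1) - C(k,
s+1), which is nonnegative to the right of k, nonpositive to the left, and at most |d-k| max(d,k)^s
in size. Induction on the distance from k sums these increments. -/
lemma chooseRemainder_bounds (s k d : ℕ) :
    0 ≤ chooseRemainder (s + 1) k d ∧
      chooseRemainder (s + 1) k d ≤ ((d : ℝ) - k) ^ 2 * (max d k : ℕ) ^ s := by
  unfold chooseRemainder
  rcases le_total k d with h | h
  · obtain ⟨j, rfl⟩ := Nat.exists_eq_add_of_le h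
    rw [max_eq_left h]
    clear h
    induction j with
    | zero => simp
    | succ j ih =>
      have h1 : ((k + (j + 1)).choose (s + 1 + 1) : ℝ) =
          (k + j).choose (s + 1) + (k + j).choose (s + 1 + 1) := by
        rw [← add_assoc, Nat.choose_succ_succ']; push_cast; ring
      have h2 := choose_sub_choose_le s k j
      have h3 : (k.choose (s + 1) : ℝ) ≤ (k + j).choose (s + 1) := by
        exact_mod_cast Nat.choose_le_choose _ (Nat.le_add_right k j)
      have h4 : ((k + j : ℕ) : ℝ) ^ s ≤ ((k + (j + 1) : ℕ) : ℝ) ^ s := by gcongr; omega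
      have h5 : (0 : ℝ) ≤ ((k + j : ℕ) : ℝ) ^ s := by positivity
      have hj : (0 : ℝ) ≤ j := Nat.cast_nonneg j
      rw [h1]
      set P := ((k + j : ℕ) : ℝ) ^ s
      set Q := ((k + (j + 1) : ℕ) : ℝ) ^ s
      push_cast at *
      constructor
      · linarith [ih.1]
      · have i2 := ih.2
        have : (k + j - k : ℝ) ^ 2 * P + j * P ≤ ((k : ℝ) + (j + 1) - k) ^ 2 * Q := by
          have e1 : (k + j - k : ℝ) ^ 2 * P + j * P = (j ^ 2 + j) * P := by ring
          have e2 : ((k : ℝ) + (j + 1) - k) ^ 2 * Q = (j ^ 2 + 2 * j + 1) * Q := by ring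
          rw [e1, e2]
          have : (0 : ℝ) ≤ j ^ 2 + j := by positivity
          calc _ ≤ ((j : ℝ) ^ 2 + j) * Q := by gcongr
            _ ≤ _ := by
              exact mul_le_mul_of_nonneg_right (by linarith) (h5.trans h4)
        linarith
  · obtain ⟨j, rfl⟩ := Nat.exists_eq_add_of_le h
    rw [max_eq_right h]
    clear h
    induction j generalizing d with
    | zero => simp
    | succ j ih =>
      have h1 : ((d + 1).choose (s + 1 + 1) : ℝ) =
          d.choose (s + 1) + d.choose (s + 1 + 1) := by
        rw [Nat.choose_succ_succ']; push_cast; ring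
      have h2 := choose_sub_choose_le s d (j + 1)
      have h3 : (d.choose (s + 1) : ℝ) ≤ (d + (j + 1)).choose (s + 1) := by
        exact_mod_cast Nat.choose_le_choose _ (Nat.le_add_right _ _)
      have e : d + 1 + j = d + (j + 1) := by ring
      have ih' := ih (d + 1)
      rw [e, h1] at ih'
      have h5 : (0 : ℝ) ≤ ((d + (j + 1) : ℕ) : ℝ) ^ s := by positivity
      have hj : (0 : ℝ) ≤ j := Nat.cast_nonneg j
      set P := ((d + (j + 1) : ℕ) : ℝ) ^ s
      push_cast at *
      constructor
      · linarith [ih'.1]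
      · have i2 := ih'.2
        have : (d + 1 - (d + (j + 1)) : ℝ) ^ 2 * P + (j + 1) * P ≤
            ((d : ℝ) - (d + (j + 1))) ^ 2 * P := by
          have e1 : (d + 1 - (d + (j + 1)) : ℝ) ^ 2 * P + (j + 1) * P = (j ^ 2 + j + 1) * P := by
            ring
          have e2 : ((d : ℝ) - (d + (j + 1))) ^ 2 * P = (j ^ 2 + 2 * j + 1) * P := by ring
          rw [e1, e2]
          gcongr; linarith
        linarith

/-- Replaces Gaussian sums: exp(-y²/(256a)) ≤ 256a/(1+y²) can be summed over d uniformly in the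
centre k. The power of a lost in this way is harmless, since the linear part of the expansion
already contributes order a^{2s+3}. -/
lemma exists_sum_range_one_div_le : ∃ C : ℝ, 0 < C ∧ ∀ (N k : ℕ),
    ∑ d ∈ Finset.range N, 1 / (1 + ((d : ℝ) - k) ^ 2) ≤ C := by
  have hs : Summable fun z : ℤ => 1 / (1 + (z : ℝ) ^ 2) := by
    refine Summable.of_norm_bounded_eventually (g := fun z : ℤ => 1 / (z : ℝ) ^ 2)
      (Real.summable_one_div_int_pow.2 (by norm_num)) ?_
    filter_upwards [Filter.eventually_cofinite_ne 0] with z hz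
    have : (0 : ℝ) < (z : ℝ) ^ 2 := by positivity
    rw [Real.norm_of_nonneg (by positivity)]
    exact one_div_le_one_div_of_le this (by linarith)
  refine ⟨∑' z : ℤ, 1 / (1 + (z : ℝ) ^ 2) + 1, ?_, fun N k => ?_⟩
  · have : 0 ≤ ∑' z : ℤ, 1 / (1 + (z : ℝ) ^ 2) := tsum_nonneg fun z => by positivity
    linarith
  · have hinj : Function.Injective fun d : ℕ => (d : ℤ) - k := by
      intro a b h; simpa using h
    have h1 : ∑ d ∈ Finset.range N, 1 / (1 + ((d : ℝ) - k) ^ 2) =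
        ∑ z ∈ (Finset.range N).map ⟨_, hinj⟩, 1 / (1 + (z : ℝ) ^ 2) := by
      rw [Finset.sum_map]
      refine Finset.sum_congr rfl fun d _ => ?_
      simp
    rw [h1]
    have := hs.sum_le_tsum ((Finset.range N).map ⟨_, hinj⟩) (fun z _ => by positivity)
    linarith

/-- Tilting by θ = (d - mp)/(16a) is permitted because |d - mp| ≤ 8a. Moving the centre from mp to
its integer part shifts it by less than 1 and costs at most the factor e. -/
lemma binomial_mass_le_exp_neg_sq {p : ℝ} {m d : ℕ} {a : ℝ} (hp0 : 0 ≤ p) (hp1 : p ≤ 1)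
    (ha1 : 1 ≤ a) (hma : m * p ≤ a) (hd : d ≤ m) (hda : (d : ℝ) ≤ 8 * a) :
    m.choose d * p ^ d * (1 - p) ^ (m - d) ≤
      Real.exp (1 - ((d : ℝ) - ⌊m * p⌋₊) ^ 2 / (64 * a)) := by
  have ha0 : 0 < a := by linarith
  set b : ℝ := m * p with hb
  have hb0 : 0 ≤ b := by positivity
  set k := ⌊b⌋₊
  have hkb : (k : ℝ) ≤ b := Nat.floor_le hb0
  have hbk : b < k + 1 := Nat.lt_floor_add_one b
  have hd0 : (0 : ℝ) ≤ d := Nat.cast_nonneg d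
  have habs : |((d : ℝ) - b) / (16 * a)| ≤ 1 := by
    rw [abs_div, abs_of_pos (by positivity : 0 < 16 * a), div_le_one (by positivity), abs_le]
    constructor <;> linarith
  refine (binomial_mass_le_exp hp0 hp1 habs hd).trans ?_
  rw [← hb]
  refine Real.exp_le_exp.2 ?_
  have e1 : b * (((d : ℝ) - b) / (16 * a)) ^ 2 ≤ ((d : ℝ) - b) ^ 2 / (256 * a) := by
    rw [div_pow, mul_div_assoc', div_le_div_iff₀ (by positivity) (by positivity)]
    have : 0 ≤ ((d : ℝ) - b) ^ 2 * a * (a - b) := by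
      have : 0 ≤ a - b := by linarith
      positivity
    nlinarith
  have e2 : ((d : ℝ) - k) ^ 2 ≤ 2 * ((d : ℝ) - b) ^ 2 + 2 := by
    have : (d : ℝ) - k = (d - b) + (b - k) := by ring
    rw [this]
    nlinarith [sq_nonneg ((d - b) - (b - k : ℝ))]
  have e3 : ((d : ℝ) - k) ^ 2 / (64 * a) ≤ (2 * ((d : ℝ) - b) ^ 2 + 2) / (64 * a) := by gcongr
  have e4 : (2 * ((d : ℝ) - b) ^ 2 + 2) / (64 * a) =
      8 * (((d : ℝ) - b) ^ 2 / (256 * a)) + 1 / (32 * a) := by field_simp; ring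
  have e5 : 1 / (32 * a) ≤ 1 := by
    rw [div_le_one (by positivity)]; linarith
  have e6 : ((d : ℝ) - b) / (16 * a) * (d - b) = 16 * (((d : ℝ) - b) ^ 2 / (256 * a)) := by
    field_simp; ring
  have e7 : 0 ≤ ((d : ℝ) - b) ^ 2 / (256 * a) := by positivity
  rw [e6]
  linarith

/-- Put u = y²/(256a). The mass is at most exp(1-4u), and the smallness of λa^{s+1}, with
1/(512·8^s) chosen for this purpose, makes the tilt at most exp(2u). Of the remaining exp(-2u), one
half absorbs the u² coming from R² and the other gives the summable factor. -/
lemma gaussian_mul_sq_mul_exp_le {s : ℕ} {a y lam R w : ℝ} (ha : 1 ≤ a)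
    (hw : w ≤ Real.exp (1 - y ^ 2 / (64 * a))) (hR0 : 0 ≤ R) (hR : R ≤ (8 * a) ^ s * y ^ 2)
    (hlam0 : 0 ≤ lam) (hlam : lam * a ^ (s + 1) ≤ 1 / (512 * 8 ^ s)) :
    w * (R ^ 2 * Real.exp (4 * lam * R)) ≤
      Real.exp 1 * 8 ^ (2 * s) * 2 * 256 ^ 3 * a ^ (2 * s + 3) * (1 / (1 + y ^ 2)) := by
  have ha0 : 0 < a := by linarith
  have hlamR : 4 * lam * R ≤ y ^ 2 / (128 * a) := by
    have e1 : 4 * lam * R ≤ 4 * lam * ((8 * a) ^ s * y ^ 2) := by gcongr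
    have e2 : 4 * lam * ((8 * a) ^ s * y ^ 2) = (lam * a ^ (s + 1)) * (4 * 8 ^ s * y ^ 2 / a) := by
      rw [mul_pow]; field_simp; ring
    have e3 : (lam * a ^ (s + 1)) * (4 * 8 ^ s * y ^ 2 / a) ≤
        1 / (512 * 8 ^ s) * (4 * 8 ^ s * y ^ 2 / a) := by gcongr
    have e4 : (1 : ℝ) / (512 * 8 ^ s) * (4 * 8 ^ s * y ^ 2 / a) = y ^ 2 / (128 * a) := by
      field_simp; ring
    linarith
  set u : ℝ := y ^ 2 / (256 * a) with hu
  have hu0 : 0 ≤ u := by positivity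
  have hyu : y ^ 2 = 256 * a * u := by rw [hu]; field_simp
  have f1 : u ^ 2 ≤ 2 * Real.exp u := by
    have := pow_le_factorial_mul_exp hu0 2
    simpa using this
  have f2 : Real.exp (-u) ≤ 256 * a * (1 / (1 + y ^ 2)) := by
    have h1 := Real.add_one_le_exp u
    rw [Real.exp_neg, mul_one_div, inv_eq_one_div, div_le_div_iff₀ (Real.exp_pos _) (by positivity),
      hyu, one_mul]
    have : 256 * a * (u + 1) ≤ 256 * a * Real.exp u := by gcongr
    linarith
  have f3 : Real.exp (1 - y ^ 2 / (64 * a)) * Real.exp (4 * lam * R) ≤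
      Real.exp 1 * (Real.exp (-u) * Real.exp (-u)) := by
    rw [← Real.exp_add, ← Real.exp_add, ← Real.exp_add]
    refine Real.exp_le_exp.2 ?_
    have g1 : y ^ 2 / (64 * a) = 4 * u := by rw [hu]; field_simp; ring
    have g2 : y ^ 2 / (128 * a) = 2 * u := by rw [hu]; field_simp; ring
    linarith
  have f4 : u ^ 2 * Real.exp (-u) ≤ 2 := by
    rw [Real.exp_neg, ← div_eq_mul_inv, div_le_iff₀ (Real.exp_pos _)]
    exact f1
  have f5 : (0 : ℝ) ≤ 1 / (1 + y ^ 2) := by positivity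
  calc w * (R ^ 2 * Real.exp (4 * lam * R))
      ≤ Real.exp (1 - y ^ 2 / (64 * a)) * (((8 * a) ^ s * y ^ 2) ^ 2 *
        Real.exp (4 * lam * R)) := by gcongr
    _ = ((8 * a) ^ s * y ^ 2) ^ 2 *
        (Real.exp (1 - y ^ 2 / (64 * a)) * Real.exp (4 * lam * R)) := by ring
    _ ≤ ((8 * a) ^ s * y ^ 2) ^ 2 * (Real.exp 1 * (Real.exp (-u) * Real.exp (-u))) := by gcongr
    _ = (8 * a) ^ (2 * s) * (256 * a) ^ 2 * Real.exp 1 * (u ^ 2 * Real.exp (-u)) *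
        Real.exp (-u) := by rw [hyu]; ring
    _ ≤ (8 * a) ^ (2 * s) * (256 * a) ^ 2 * Real.exp 1 * 2 *
        (256 * a * (1 / (1 + y ^ 2))) := by gcongr
    _ = _ := by rw [mul_pow]; ring

/-- With ℓ = log(d/a), the mass is at most exp(d - dℓ), the tilt at most exp(dℓ/8), and R² at most a
constant times exp(d/4). Since ℓ ≥ 2, the total exponent is at most -d/2. -/
lemma tail_mul_sq_mul_exp_le {s d : ℕ} {a lam R w : ℝ} (ha : 1 ≤ a) (hda : 8 * a ≤ d)
    (hw : w ≤ a ^ d / d.factorial) (hR0 : 0 ≤ R) (hR : R ≤ (d : ℝ) ^ (s + 2))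
    (hlam0 : 0 ≤ lam) (hlam : lam * (d : ℝ) ^ (s + 1) ≤ 1 / 32 * Real.log (d / a)) :
    w * (R ^ 2 * Real.exp (4 * lam * R)) ≤
      (2 * (s + 2)).factorial * 4 ^ (2 * (s + 2)) * Real.exp (-((d : ℝ) / 2)) := by
  have ha0 : 0 < a := by linarith
  have hdpos : (0 : ℝ) < d := by linarith
  set ℓ := Real.log (d / a) with hℓ
  -- The threshold 8a between bulk and tail is used here, through 8 ≥ e².
  have hℓ2 : 2 ≤ ℓ := by
    rw [hℓ, Real.le_log_iff_exp_le (by positivity), le_div_iff₀ ha0]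
    have e2 : Real.exp 2 ≤ 8 := by
      have := Real.exp_one_lt_d9
      have e : Real.exp 2 = Real.exp 1 ^ 2 := by rw [← Real.exp_nat_mul]; norm_num
      rw [e]
      have h0 := Real.exp_pos 1
      nlinarith
    nlinarith
  have hmass : w ≤ Real.exp (d - d * ℓ) := by
    refine hw.trans ?_
    rw [div_le_iff₀ (by positivity)]
    have e1 : Real.exp (d - d * ℓ) = Real.exp d * (a / d) ^ d := by
      rw [sub_eq_add_neg, Real.exp_add, ← mul_neg, Real.exp_nat_mul (-ℓ) d, hℓ, Real.exp_neg,
        Real.exp_log (by positivity), inv_div]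
    rw [e1, div_pow]
    have := self_pow_le_exp_mul_factorial d
    have hdd : (0 : ℝ) < (d : ℝ) ^ d := by positivity
    have had : (0 : ℝ) ≤ a ^ d := by positivity
    rw [mul_div_assoc', div_mul_eq_mul_div, le_div_iff₀ hdd]
    have := mul_le_mul_of_nonneg_left this had
    linarith
  have hlamR : 4 * lam * R ≤ d * ℓ / 8 := by
    have e1 : 4 * lam * R ≤ 4 * lam * (d : ℝ) ^ (s + 2) := by gcongr
    have e2 : 4 * lam * (d : ℝ) ^ (s + 2) = 4 * d * (lam * (d : ℝ) ^ (s + 1)) := by ring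
    have e3 : 4 * d * (lam * (d : ℝ) ^ (s + 1)) ≤ 4 * d * (1 / 32 * ℓ) := by gcongr
    linarith
  set C : ℝ := (2 * (s + 2)).factorial * 4 ^ (2 * (s + 2)) with hC
  have hpow : ((d : ℝ) ^ (s + 2)) ^ 2 ≤ C * Real.exp (d / 4) := by
    have := pow_le_factorial_mul_exp (by positivity : (0 : ℝ) ≤ d / 4) (2 * (s + 2))
    rw [div_pow, div_le_iff₀ (by positivity)] at this
    calc ((d : ℝ) ^ (s + 2)) ^ 2 = (d : ℝ) ^ (2 * (s + 2)) := by rw [← pow_mul]; ring_nf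
      _ ≤ _ := this
      _ = _ := by rw [hC]; ring
  have hC0 : 0 ≤ C := by positivity
  have hdℓ : (d : ℝ) * 2 ≤ d * ℓ := by gcongr
  calc w * (R ^ 2 * Real.exp (4 * lam * R))
      ≤ Real.exp (d - d * ℓ) * (((d : ℝ) ^ (s + 2)) ^ 2 * Real.exp (d * ℓ / 8)) := by gcongr
    _ ≤ Real.exp (d - d * ℓ) * (C * Real.exp (d / 4) * Real.exp (d * ℓ / 8)) := by gcongr
    _ = C * Real.exp (d - d * ℓ + d / 4 + d * ℓ / 8) := by
      rw [Real.exp_add, Real.exp_add]; ring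
    _ ≤ C * Real.exp (-((d : ℝ) / 2)) := by
      gcongr
      linarith

/-- In the dense range, the exponential second moment of the truncated Taylor remainder of a
binomial variable of mean at most `a`, where `1 ≤ a`. -/
lemma exists_binExp_chooseRemainder_le (s : ℕ) : ∃ C η : ℝ, 0 < C ∧ 0 < η ∧ η ≤ 1 / 32 ∧
    ∀ (p : ℝ) (m : ℕ) (a K lam : ℝ), 0 ≤ p → p ≤ 1 → 1 ≤ a → m * p ≤ a → 0 ≤ lam →
      lam * a ^ (s + 1) ≤ η →
      (∀ d : ℕ, 8 * a ≤ d → (d : ℝ) ≤ K → d ≤ m →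
        lam * (d : ℝ) ^ (s + 1) ≤ η * Real.log (d / a)) →
      binExp p m (fun d => (if (d : ℝ) ≤ K then chooseRemainder (s + 1) ⌊m * p⌋₊ d else 0) ^ 2 *
        Real.exp (4 * lam *
          if (d : ℝ) ≤ K then chooseRemainder (s + 1) ⌊m * p⌋₊ d else 0)) ≤
        C * a ^ (2 * s + 3) := by
  obtain ⟨C₁, hC₁, hsum⟩ := exists_sum_range_one_div_le
  set C₂ : ℝ := (2 * (s + 2)).factorial * 4 ^ (2 * (s + 2)) with hC₂
  set C₃ : ℝ := Real.exp 1 * 8 ^ (2 * s) * 2 * 256 ^ 3 with hC₃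
  have hC₂0 : 0 < C₂ := by positivity
  have hC₃0 : 0 < C₃ := by positivity
  refine ⟨C₃ * C₁ + C₂ * 3, 1 / (512 * 8 ^ s), by positivity, by positivity, ?_, ?_⟩
  · rw [div_le_div_iff₀ (by positivity) (by norm_num)]
    have : (1 : ℝ) ≤ 8 ^ s := one_le_pow₀ (by norm_num)
    linarith
  intro p m a K lam hp0 hp1 ha1 hma hlam hlama hR
  have h8 : (1 : ℝ) ≤ 8 ^ s := one_le_pow₀ (by norm_num)
  have ha0 : 0 < a := by linarith
  set b : ℝ := m * p with hb
  have hb0 : 0 ≤ b := by positivity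
  set k := ⌊b⌋₊ with hk
  have hkb : (k : ℝ) ≤ b := Nat.floor_le hb0
  set R := chooseRemainder (s + 1) k with hRdef
  have hcd : ∀ d ≤ m, m.choose d * p ^ d * (1 - p) ^ (m - d) *
      ((if (d : ℝ) ≤ K then R d else 0) ^ 2 *
        Real.exp (4 * lam * if (d : ℝ) ≤ K then R d else 0)) ≤
      C₃ * a ^ (2 * s + 3) * (1 / (1 + ((d : ℝ) - k) ^ 2)) +
        C₂ * a ^ (2 * s + 3) * Real.exp (-((d : ℝ) / 2)) := by
    intro d hd
    have hA0 : 0 ≤ C₃ * a ^ (2 * s + 3) * (1 / (1 + ((d : ℝ) - k) ^ 2)) := by positivity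
    have hB0 : 0 ≤ C₂ * a ^ (2 * s + 3) * Real.exp (-((d : ℝ) / 2)) := by positivity
    obtain ⟨hR0, hR1⟩ := chooseRemainder_bounds s k d
    rw [← hRdef] at hR0 hR1
    have hd0 : (0 : ℝ) ≤ d := Nat.cast_nonneg d
    have hk0 : (0 : ℝ) ≤ k := Nat.cast_nonneg k
    by_cases hdK : (d : ℝ) ≤ K
    swap
    · simp only [if_neg hdK]
      norm_num
      norm_num at hA0 hB0
      linarith
    simp only [if_pos hdK]
    by_cases hda : (d : ℝ) < 8 * a
    · refine le_trans ?_ (le_add_of_nonneg_right hB0)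
      have hmax : ((max d k : ℕ) : ℝ) ≤ 8 * a := by
        push_cast; exact max_le hda.le (by linarith)
      refine gaussian_mul_sq_mul_exp_le ha1
        (binomial_mass_le_exp_neg_sq hp0 hp1 ha1 hma hd hda.le) hR0 ?_ hlam hlama
      calc R d ≤ ((d : ℝ) - k) ^ 2 * (max d k : ℕ) ^ s := hR1
        _ ≤ ((d : ℝ) - k) ^ 2 * (8 * a) ^ s := by gcongr
        _ = _ := by ring
    · push Not at hda
      refine le_trans ?_ (le_add_of_nonneg_left hA0)
      have hkd : (k : ℝ) ≤ d := by linarith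
      have hRd : R d ≤ (d : ℝ) ^ (s + 2) := by
        calc R d ≤ ((d : ℝ) - k) ^ 2 * (max d k : ℕ) ^ s := hR1
          _ ≤ (d : ℝ) ^ 2 * (d : ℝ) ^ s := by
            rw [max_eq_left (by exact_mod_cast hkd)]
            have : (0 : ℝ) ≤ (d : ℝ) - k := by linarith
            gcongr
            linarith
          _ = _ := by ring
      have hlog : 0 ≤ Real.log (d / a) :=
        Real.log_nonneg ((one_le_div ha0).2 (by linarith))
      have hη : (1 : ℝ) / (512 * 8 ^ s) ≤ 1 / 32 :=
        one_div_le_one_div_of_le (by norm_num) (by linarith)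
      refine (tail_mul_sq_mul_exp_le ha1 hda
        (binomial_mass_le_pow_div_factorial hp0 hp1 hma d) hR0 hRd hlam
        ((hR d hda hdK hd).trans (mul_le_mul_of_nonneg_right hη hlog))).trans ?_
      rw [← hC₂]
      have : (1 : ℝ) ≤ a ^ (2 * s + 3) := one_le_pow₀ ha1
      have h1 := mul_le_mul_of_nonneg_left this
        (by positivity : 0 ≤ C₂ * Real.exp (-((d : ℝ) / 2)))
      linarith
  refine (binExp_le_sum hcd).trans ?_
  rw [Finset.sum_add_distrib, ← Finset.mul_sum, ← Finset.mul_sum]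
  have h1 := mul_le_mul_of_nonneg_left (hsum (m + 1) k)
    (by positivity : 0 ≤ C₃ * a ^ (2 * s + 3))
  have h2 := mul_le_mul_of_nonneg_left (sum_range_exp_neg_div_two_le (m + 1))
    (by positivity : 0 ≤ C₂ * a ^ (2 * s + 3))
  linarith

/-! ### Moment generating function of a single degree -/

/-- A constant `κ` such that `κ * n ^ r ≤ (n - 1).choose r` for all `n > r`. -/
noncomputable def chooseRatio (r : ℕ) : ℝ := 1 / ((r + 1) ^ r * r.factorial)

lemma chooseRatio_pos (r : ℕ) : 0 < chooseRatio r := by unfold chooseRatio; positivity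

lemma chooseRatio_le_one (r : ℕ) : chooseRatio r ≤ 1 := by
  unfold chooseRatio
  rw [div_le_one (by positivity)]
  have h1 : (1 : ℝ) ≤ (r + 1) ^ r := one_le_pow₀ (by linarith [(Nat.cast_nonneg r : (0 : ℝ) ≤ r)])
  have h2 : (1 : ℝ) ≤ r.factorial := by exact_mod_cast Nat.one_le_iff_ne_zero.2 r.factorial_ne_zero
  nlinarith

lemma chooseRatio_mul_pow_le {r n : ℕ} (hn : r + 1 ≤ n) :
    chooseRatio r * (n : ℝ) ^ r ≤ (n - 1).choose r := by
  have h1 : ((n - r : ℕ) : ℝ) ^ r ≤ r.factorial * (n - 1).choose r := by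
    have := Nat.pow_le_choose (α := ℝ) r (n - 1)
    have e : n - 1 + 1 - r = n - r := by omega
    rw [e, div_le_iff₀ (by positivity)] at this
    linarith
  have h2 : (n : ℝ) ≤ (r + 1) * (n - r : ℕ) := by
    rw [Nat.cast_sub (by omega)]
    have : (r : ℝ) + 1 ≤ n := by exact_mod_cast hn
    nlinarith [(Nat.cast_nonneg r : (0 : ℝ) ≤ r)]
  have h3 : (n : ℝ) ^ r ≤ (r + 1) ^ r * (r.factorial * (n - 1).choose r) := by
    calc (n : ℝ) ^ r ≤ ((r + 1) * (n - r : ℕ)) ^ r := by gcongr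
      _ = (r + 1) ^ r * ((n - r : ℕ) : ℝ) ^ r := by rw [mul_pow]
      _ ≤ _ := by gcongr
  unfold chooseRatio
  rw [div_mul_eq_mul_div, div_le_iff₀ (by positivity)]
  linarith

/-- Used with x = t/μ to bound λ exp(2λ) by a multiple of x when λ is at most a small multiple of
log(1+x), since then exp(2λ) ≤ √(1+x). -/
lemma log_one_add_mul_sqrt_le {x : ℝ} (hx : 0 ≤ x) : Real.log (1 + x) * √(1 + x) ≤ 2 * x := by
  have h1 : 1 ≤ √(1 + x) := Real.one_le_sqrt.2 (by linarith)
  have h2 : Real.log (1 + x) ≤ 2 * (√(1 + x) - 1) := by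
    have e : Real.log (1 + x) = 2 * Real.log (√(1 + x)) := by
      rw [Real.log_sqrt (by linarith)]; ring
    rw [e]
    have := Real.log_le_sub_one_of_pos (by linarith : 0 < √(1 + x))
    linarith
  have h3 := Real.sq_sqrt (by linarith : 0 ≤ 1 + x)
  nlinarith

/-- Truncation only lowers the mean, so the linear term is at most 2λm₀. The quadratic term has
order λ²a^r exp(2λ) and must fit into λt/n = λxm₀ with x = t/μ; as m₀ ≥ κa^r, it suffices that λ
exp(2λ) is a small multiple of x. -/
lemma exists_mgf_le_of_sparse (r : ℕ) (hr : 2 ≤ r) : ∃ η : ℝ, 0 < η ∧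
    ∀ (n : ℕ) (p K lam t : ℝ), r + 1 ≤ n → 0 < p → p ≤ 1 → n * p ≤ 1 → 0 ≤ lam → 0 < t →
      lam ≤ η * Real.log (1 + t / (n * ((n - 1).choose r * p ^ r))) →
      (∀ d : ℕ, 3 ≤ d → (d : ℝ) ≤ K → d ≤ n - 1 →
        lam * (d : ℝ) ^ (r - 1) ≤ η * Real.log (d / (n * p))) →
      binExp p (n - 1)
        (fun d => Real.exp (2 * (lam * if (d : ℝ) ≤ K then (d.choose r : ℝ) else 0))) ≤
        Real.exp (2 * lam * ((n - 1).choose r * p ^ r) + lam * t / n) := by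
  obtain ⟨C, hC, hmain⟩ := exists_binExp_choose_sq_mul_exp_le r hr
  have hκ := chooseRatio_pos r
  set κ := chooseRatio r with hκdef
  refine ⟨min (1 / (4 * (r + 1))) (κ / (8 * C)), by positivity, ?_⟩
  intro n p K lam t hn hp0 hp1 hnp hlam ht hlamlog hR
  set η : ℝ := min (1 / (4 * (r + 1))) (κ / (8 * C)) with hη
  have hη0 : 0 < η := by positivity
  have hη1 : η ≤ 1 / (4 * (r + 1)) := min_le_left _ _
  have hη2 : η ≤ κ / (8 * C) := min_le_right _ _
  have hη3 : η ≤ 1 / 4 := hη1.trans (one_div_le_one_div_of_le (by norm_num)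
    (by linarith [(Nat.cast_nonneg r : (0 : ℝ) ≤ r)]))
  have hn0 : (0 : ℝ) < n := by
    have : 0 < n := by omega
    exact_mod_cast this
  set a : ℝ := n * p with ha
  have ha0 : 0 < a := by positivity
  have hma : ((n - 1 : ℕ) : ℝ) * p ≤ a := by
    rw [ha]
    have : ((n - 1 : ℕ) : ℝ) ≤ n := by exact_mod_cast Nat.sub_le _ _
    gcongr
  have hch := chooseRatio_mul_pow_le hn
  rw [← hκdef] at hch
  set m0 : ℝ := (n - 1).choose r * p ^ r with hm0
  have hm0a : κ * a ^ r ≤ m0 := by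
    rw [ha, hm0, mul_pow, ← mul_assoc]; gcongr
  have hm0pos : 0 < m0 := lt_of_lt_of_le (by positivity) hm0a
  set x : ℝ := t / (n * m0) with hx
  have hx0 : 0 < x := by positivity
  have htx : t = x * (n * m0) := by rw [hx]; field_simp
  set f1 : ℕ → ℝ := fun d => if (d : ℝ) ≤ K then (d.choose r : ℝ) else 0 with hf1
  have hf0 : ∀ d, 0 ≤ f1 d := fun d => by simp only [hf1]; split_ifs <;> positivity
  have h1 := hmain p (n - 1) a K lam hp0.le hp1 ha0 hnp hma hlam (by
    intro d h3 hdK hdn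
    have hlog : 0 ≤ Real.log (d / a) := by
      refine Real.log_nonneg ((one_le_div ha0).2 ?_)
      have : (3 : ℝ) ≤ d := by exact_mod_cast h3
      linarith
    exact (hR d h3 hdK hdn).trans (mul_le_mul_of_nonneg_right hη1 hlog))
  have h2 := binExp_exp_two_mul_le (p := p) (m := n - 1) hp0.le hp1
    (by positivity : 0 ≤ 2 * lam) hf0
  have h3 : binExp p (n - 1) f1 ≤ m0 := by
    rw [hm0, ← binExp_choose]
    refine binExp_mono hp0.le hp1 fun d _ => ?_
    simp only [hf1]
    split_ifs
    · exact le_rfl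
    · positivity
  have hlogx : 0 ≤ Real.log (1 + x) := Real.log_nonneg (by linarith)
  have hexp : Real.exp (2 * lam) ≤ √(1 + x) := by
    have : 2 * lam ≤ Real.log (1 + x) / 2 := by nlinarith
    calc Real.exp (2 * lam) ≤ Real.exp (Real.log (1 + x) / 2) := Real.exp_le_exp.2 this
      _ = √(1 + x) := by rw [Real.exp_half, Real.exp_log (by linarith)]
  have hkey : lam * Real.exp (2 * lam) ≤ κ / (4 * C) * x := by
    calc lam * Real.exp (2 * lam) ≤ (κ / (8 * C) * Real.log (1 + x)) * √(1 + x) := by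
          gcongr
          exact hlamlog.trans (mul_le_mul_of_nonneg_right hη2 hlogx)
      _ = κ / (8 * C) * (Real.log (1 + x) * √(1 + x)) := by ring
      _ ≤ κ / (8 * C) * (2 * x) := by
          have := log_one_add_mul_sqrt_le hx0.le
          gcongr
      _ = _ := by field_simp; ring
  have hfin : (2 * lam) ^ 2 * (C * a ^ r * Real.exp (2 * lam)) ≤ lam * t / n := by
    have e1 : (2 * lam) ^ 2 * (C * a ^ r * Real.exp (2 * lam)) =
        lam * (4 * C * a ^ r) * (lam * Real.exp (2 * lam)) := by ring
    have e2 : lam * (4 * C * a ^ r) * (lam * Real.exp (2 * lam)) ≤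
        lam * (4 * C * a ^ r) * (κ / (4 * C) * x) := by gcongr
    have e3 : lam * (4 * C * a ^ r) * (κ / (4 * C) * x) = lam * x * (κ * a ^ r) := by
      field_simp
    have e4 : lam * x * (κ * a ^ r) ≤ lam * x * m0 := by gcongr
    have e5 : lam * t / n = lam * x * m0 := by rw [htx]; field_simp
    rw [e5, e1]
    linarith
  have e0 : (fun d : ℕ => Real.exp (2 * (lam * f1 d))) = fun d => Real.exp (2 * lam * f1 d) := by
    ext d; ring_nf
  change binExp p (n - 1) (fun d => Real.exp (2 * (lam * f1 d))) ≤ _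
  rw [e0]
  refine h2.trans (Real.exp_le_exp.2 ?_)
  refine add_le_add (by gcongr) ?_
  exact (mul_le_mul_of_nonneg_left h1 (by positivity)).trans hfin

/-- Only λa^{r-1} is known to be small, not λa^r, so C(d, r) cannot be expanded directly. Its
tangent line at ⌊(n-1)p⌋ is removed: the linear part and the remainder each produce an error of
order λ²a^{2r-1}, and the mean ρ of the remainder cancels because m₀ is the mean of the full
expression. The errors fit into λt/n since λa^{r-1} ≤ ηx with x = t/μ. -/
lemma exists_mgf_le_of_dense (r : ℕ) (hr : 2 ≤ r) : ∃ η : ℝ, 0 < η ∧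
    ∀ (n : ℕ) (p K lam t : ℝ), r + 1 ≤ n → 0 < p → p ≤ 1 → 1 ≤ n * p → 0 ≤ lam → 0 < t →
      lam * (1 + (n * p) ^ (r - 1)) ≤
        η * Real.log (1 + t / (n * ((n - 1).choose r * p ^ r))) →
      lam * (n * p) ^ (r - 1) ≤ η → n * p ≤ K →
      (∀ d : ℕ, 8 * (n * p) ≤ d → (d : ℝ) ≤ K → d ≤ n - 1 →
        lam * (d : ℝ) ^ (r - 1) ≤ η * Real.log (d / (n * p))) →
      binExp p (n - 1)
        (fun d => Real.exp (2 * (lam * if (d : ℝ) ≤ K then (d.choose r : ℝ) else 0))) ≤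
        Real.exp (2 * lam * ((n - 1).choose r * p ^ r) + lam * t / n) := by
  obtain ⟨s, rfl⟩ : ∃ s, r = s + 2 := ⟨r - 2, by omega⟩
  obtain ⟨C, η₁, hC, hη₁, hη₁', hmain⟩ := exists_binExp_chooseRemainder_le s
  have hκ := chooseRatio_pos (s + 2)
  set κ := chooseRatio (s + 2) with hκdef
  refine ⟨min η₁ (κ / (8 * (C + 1))), by positivity, ?_⟩
  intro n p K lam t hn hp0 hp1 hnp hlam ht hlamlog hlama hK hR
  set η : ℝ := min η₁ (κ / (8 * (C + 1))) with hη
  have hη0 : 0 < η := by positivity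
  have hη1 : η ≤ η₁ := min_le_left _ _
  have hη2 : η ≤ κ / (8 * (C + 1)) := min_le_right _ _
  have es : s + 2 - 1 = s + 1 := by omega
  rw [es] at hlamlog hlama hR
  have hn0 : (0 : ℝ) < n := by
    have : 0 < n := by omega
    exact_mod_cast this
  set a : ℝ := n * p with ha
  have ha0 : 0 < a := by positivity
  set b : ℝ := ((n - 1 : ℕ) : ℝ) * p with hb
  have hb0 : 0 ≤ b := by positivity
  have hma : b ≤ a := by
    rw [ha, hb]
    have : ((n - 1 : ℕ) : ℝ) ≤ n := by exact_mod_cast Nat.sub_le _ _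
    gcongr
  have hch := chooseRatio_mul_pow_le hn
  rw [← hκdef] at hch
  set m0 : ℝ := (n - 1).choose (s + 2) * p ^ (s + 2) with hm0
  have hm0a : κ * a ^ (s + 2) ≤ m0 := by
    rw [ha, hm0, mul_pow, ← mul_assoc]; gcongr
  have hm0pos : 0 < m0 := lt_of_lt_of_le (by positivity) hm0a
  set x : ℝ := t / (n * m0) with hx
  have hx0 : 0 < x := by positivity
  have htx : t = x * (n * m0) := by rw [hx]; field_simp
  set k := ⌊b⌋₊ with hk
  have hkb : (k : ℝ) ≤ b := Nat.floor_le hb0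
  set R : ℕ → ℝ := chooseRemainder (s + 1) k with hRdef
  have hR0 : ∀ d, 0 ≤ R d := fun d => (chooseRemainder_bounds s k d).1
  set A : ℝ := ((k.choose (s + 1) : ℕ) : ℝ) with hA
  have hA0 : 0 ≤ A := by positivity
  have hAa : A ≤ a ^ (s + 1) := by
    calc A ≤ (k : ℝ) ^ (s + 1) := by rw [hA]; exact_mod_cast Nat.choose_le_pow k (s + 1)
      _ ≤ a ^ (s + 1) := by gcongr; linarith
  set Rt : ℕ → ℝ := fun d => if (d : ℝ) ≤ K then R d else 0 with hRt
  have hRt0 : ∀ d, 0 ≤ Rt d := fun d => by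
    simp only [hRt]; split_ifs
    · exact hR0 d
    · exact le_rfl
  set ρ := binExp p (n - 1) R with hρ
  have hbin1 : binExp p (n - 1) (fun d => (d : ℝ)) = b := by
    have := binExp_choose p (n - 1) 1
    simpa using this
  have hmean : m0 = k.choose (s + 2) + A * (b - k) + ρ := by
    have h1 : (fun d : ℕ => (d.choose (s + 2) : ℝ)) =
        fun d => (k.choose (s + 2) - A * k : ℝ) + (A * d + R d) := by
      ext d
      simp only [hRdef, chooseRemainder]
      ring
    rw [hm0, ← binExp_choose, h1, binExp_add, binExp_const, binExp_add, binExp_mul_left, hbin1]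
    ring
  have hRtρ : binExp p (n - 1) Rt ≤ ρ := by
    refine binExp_mono hp0.le hp1 fun d _ => ?_
    simp only [hRt]
    split_ifs
    · exact le_rfl
    · exact hR0 d
  -- Above K the left side is 0. There d > K ≥ np ≥ b makes the linear term nonnegative, and ρ ≤ m₀,
  -- so the right side remains a majorant.
  have hpt : ∀ d : ℕ, (if (d : ℝ) ≤ K then (d.choose (s + 2) : ℝ) else 0) ≤
      m0 + A * (d - b) + (Rt d - ρ) := by
    intro d
    simp only [hRt]
    split_ifs with hd
    · rw [hmean]
      simp only [hRdef, chooseRemainder]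
      linarith
    · have h1 : 0 ≤ A * (d - b) := mul_nonneg hA0 (by linarith)
      have h2 : ρ ≤ m0 := by
        have h3 : 0 ≤ A * (b - k) := mul_nonneg hA0 (by linarith)
        have h4 : (0 : ℝ) ≤ k.choose (s + 2) := by positivity
        linarith
      linarith
  have hlin : binExp p (n - 1) (fun d => Real.exp (2 * lam * A * (d - b)) ^ 2) ≤
      Real.exp (16 * lam ^ 2 * a ^ (2 * s + 3)) := by
    have h1 : |4 * lam * A| ≤ 1 := by
      rw [abs_of_nonneg (by positivity)]
      have : lam * A ≤ lam * a ^ (s + 1) := by gcongr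
      linarith
    have h2 := binExp_exp_le (m := n - 1) hp0.le hp1 h1
    refine le_trans (le_of_eq (binExp_congr fun d _ => ?_)) (h2.trans (Real.exp_le_exp.2 ?_))
    · rw [← Real.exp_nat_mul, ← hb]; push_cast; ring_nf
    · rw [← hb]
      calc b * (4 * lam * A) ^ 2 ≤ a * (4 * lam * a ^ (s + 1)) ^ 2 := by gcongr
        _ = _ := by ring
  have hrem : binExp p (n - 1) (fun d => Real.exp (2 * lam * Rt d) ^ 2) ≤
      Real.exp (4 * lam * ρ + 16 * lam ^ 2 * (C * a ^ (2 * s + 3))) := by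
    have h1 := hmain p (n - 1) a K lam hp0.le hp1 hnp hma hlam (hlama.trans hη1) (by
      intro d h8 hdK hdn
      have hlog : 0 ≤ Real.log (d / a) :=
        Real.log_nonneg ((one_le_div ha0).2 (by linarith))
      exact (hR d h8 hdK hdn).trans (mul_le_mul_of_nonneg_right hη1 hlog))
    have h2 := binExp_exp_two_mul_le (p := p) (m := n - 1) hp0.le hp1
      (by positivity : 0 ≤ 4 * lam) hRt0
    refine le_trans (le_of_eq (binExp_congr fun d _ => ?_)) (h2.trans (Real.exp_le_exp.2 ?_))
    · rw [← Real.exp_nat_mul]; push_cast; ring_nf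
    · refine add_le_add (by gcongr) ?_
      calc (4 * lam) ^ 2 * _ ≤ (4 * lam) ^ 2 * (C * a ^ (2 * s + 3)) := by
            gcongr
        _ = _ := by ring
  -- Cauchy–Schwarz separates the linear part from the remainder, which is why both are controlled
  -- at the doubled parameter 4λ.
  have hcs := binExp_mul_le_sqrt_mul_sqrt hp0.le hp1 (n - 1)
    (fun d => Real.exp (2 * lam * A * (d - b))) (fun d => Real.exp (2 * lam * Rt d))
  have hprod : binExp p (n - 1)
      (fun d => Real.exp (2 * lam * A * (d - b)) * Real.exp (2 * lam * Rt d)) ≤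
      Real.exp (8 * lam ^ 2 * a ^ (2 * s + 3)) *
        Real.exp (2 * lam * ρ + 8 * lam ^ 2 * (C * a ^ (2 * s + 3))) := by
    refine hcs.trans (mul_le_mul ?_ ?_ (Real.sqrt_nonneg _) (Real.exp_pos _).le)
    · refine (Real.sqrt_le_sqrt hlin).trans (le_of_eq ?_)
      rw [← Real.exp_half]; ring_nf
    · refine (Real.sqrt_le_sqrt hrem).trans (le_of_eq ?_)
      rw [← Real.exp_half]; ring_nf
  have hlamx : lam * a ^ (s + 1) ≤ κ / (8 * (C + 1)) * x := by
    have h1 : Real.log (1 + x) ≤ x := by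
      have := Real.log_le_sub_one_of_pos (by linarith : 0 < 1 + x)
      linarith
    calc lam * a ^ (s + 1) ≤ lam * (1 + a ^ (s + 1)) := by gcongr; simp
      _ ≤ η * Real.log (1 + x) := hlamlog
      _ ≤ η * x := by gcongr
      _ ≤ _ := by gcongr
  have hfin : 8 * lam ^ 2 * a ^ (2 * s + 3) + 8 * lam ^ 2 * (C * a ^ (2 * s + 3)) ≤
      lam * t / n := by
    have e1 : 8 * lam ^ 2 * a ^ (2 * s + 3) + 8 * lam ^ 2 * (C * a ^ (2 * s + 3)) =
        lam * (8 * (C + 1) * a ^ (s + 2)) * (lam * a ^ (s + 1)) := by ring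
    have e2 : lam * (8 * (C + 1) * a ^ (s + 2)) * (lam * a ^ (s + 1)) ≤
        lam * (8 * (C + 1) * a ^ (s + 2)) * (κ / (8 * (C + 1)) * x) := by gcongr
    have e3 : lam * (8 * (C + 1) * a ^ (s + 2)) * (κ / (8 * (C + 1)) * x) =
        lam * x * (κ * a ^ (s + 2)) := by field_simp
    have e4 : lam * x * (κ * a ^ (s + 2)) ≤ lam * x * m0 := by gcongr
    have e5 : lam * t / n = lam * x * m0 := by rw [htx]; field_simp
    rw [e5, e1]
    linarith
  calc _ ≤ binExp p (n - 1) (fun d => Real.exp (2 * lam * m0 - 2 * lam * ρ) *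
        (Real.exp (2 * lam * A * (d - b)) * Real.exp (2 * lam * Rt d))) := by
        refine binExp_mono hp0.le hp1 fun d _ => ?_
        rw [← Real.exp_add, ← Real.exp_add]
        refine Real.exp_le_exp.2 ?_
        have := mul_le_mul_of_nonneg_left (hpt d) (by positivity : 0 ≤ 2 * lam)
        linarith
    _ ≤ Real.exp (2 * lam * m0 - 2 * lam * ρ) * (Real.exp (8 * lam ^ 2 * a ^ (2 * s + 3)) *
        Real.exp (2 * lam * ρ + 8 * lam ^ 2 * (C * a ^ (2 * s + 3)))) := by
        rw [binExp_mul_left]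
        gcongr
    _ ≤ _ := by
        rw [← Real.exp_add, ← Real.exp_add]
        refine Real.exp_le_exp.2 ?_
        linarith

/-! ### Truncation levels -/

/-- `K` is a good truncation level for the degrees of `G_{n,p}`, for the exponential moment of
order `lam` of the number of `K_{1,r}` copies and deviations of size `t`. -/
structure IsTruncation (η : ℝ) (r n : ℕ) (p lam t K : ℝ) : Prop where
  mean_le : n * p ≤ K
  growth : ∀ d : ℕ, 3 ≤ d → 3 * (n * p) ≤ d → (d : ℝ) ≤ K → d ≤ n - 1 →
    lam * (d : ℝ) ^ (r - 1) ≤ η * Real.log (d / (n * p))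
  tail : (n : ℝ) ^ 2 * binExp p (n - 1) (fun d => if K < (d : ℝ) then 1 else 0) ≤
    Real.exp (-(lam * t / 2))

lemma binExp_indicator_eq_zero {p K : ℝ} {m : ℕ} (hK : (m : ℝ) ≤ K) :
    binExp p m (fun d => if K < (d : ℝ) then 1 else 0) = 0 := by
  refine (binExp_congr (G := fun _ => 0) fun d hd => ?_).trans (binExp_const p m 0)
  have : (d : ℝ) ≤ m := by exact_mod_cast hd
  rw [if_neg (by linarith)]

lemma log_one_add_le_self {x : ℝ} (hx : 0 ≤ x) : Real.log (1 + x) ≤ x := by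
  have := Real.log_le_sub_one_of_pos (by linarith : 0 < 1 + x)
  linarith

lemma one_le_log_three : 1 ≤ Real.log 3 := by
  rw [Real.le_log_iff_exp_le (by norm_num)]
  linarith [Real.exp_one_lt_d9]

lemma one_add_log_le_two_mul_sqrt {x : ℝ} (hx : 0 < x) : 1 + Real.log x ≤ 2 * √x := by
  have := Real.log_le_sub_one_of_pos (Real.sqrt_pos.2 hx)
  rw [Real.log_sqrt hx.le] at this
  linarith

/-- The size of the exponent compared to `(np)^{r-1}` when `1 ≤ np`. -/
lemma mul_pow_le_of_dense {r n : ℕ} (hr : 2 ≤ r) {η η₀ κ p τ lam : ℝ} (hκ : 0 < κ) (hη₀ : 0 ≤ η₀)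
    (h1 : η₀ ≤ η * κ) (h2 : η₀ ≤ η / 2) (hn : 0 < n) (hp0 : 0 < p) (hp1 : p ≤ 1) (hτ : 0 < τ)
    (hlam : 0 ≤ lam) (hnp : 1 ≤ n * p)
    (hl1 : lam * (1 + (n * p) ^ (r - 1)) ≤ η₀ * Real.log (1 + τ ^ r / (κ * (n * (n * p) ^ r))))
    (hl2 : lam * (min τ n) ^ (r - 1) ≤ η₀ * (1 - Real.log p)) :
    lam * (n * p) ^ (r - 1) ≤ η := by
  have hn0 : (0 : ℝ) < n := by exact_mod_cast hn
  set a : ℝ := n * p with ha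
  have ha0 : 0 < a := by linarith
  have hη : 0 ≤ η := by linarith
  rcases le_or_gt (τ ^ r) (n * a ^ r) with hc | hc
  · have e1 : τ ^ r / (κ * (n * a ^ r)) ≤ 1 / κ := by
      rw [div_le_div_iff₀ (by positivity) hκ]
      nlinarith
    have e2 : Real.log (1 + τ ^ r / (κ * (n * a ^ r))) ≤ 1 / κ :=
      (log_one_add_le_self (by positivity)).trans e1
    calc lam * a ^ (r - 1) ≤ lam * (1 + a ^ (r - 1)) := by gcongr; simp
      _ ≤ η₀ * (1 / κ) := hl1.trans (by gcongr)
      _ ≤ η * κ * (1 / κ) := by gcongr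
      _ = η := by field_simp
  -- Now t > n a^r. If τ ≤ n, then w = a/τ satisfies n w^r ≤ 1, so w^{r-1} ≤ n^{-1/2} because 2(r-1)
  -- ≥ r. This outweighs log(e/p) ≤ 2√n, which follows from np ≥ 1.
  · rcases le_or_gt τ n with hτn | hτn
    · rw [min_eq_left hτn] at hl2
      set w : ℝ := a / τ with hw
      have hw0 : 0 < w := by positivity
      have hwr : n * w ^ r ≤ 1 := by
        rw [hw, div_pow, mul_div_assoc', div_le_one (by positivity)]
        exact hc.le
      have hw1 : w ≤ 1 := by
        by_contra hcon
        push Not at hcon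
        have : 1 < w ^ r := one_lt_pow₀ hcon (by omega)
        have : (1 : ℝ) ≤ n := by exact_mod_cast hn
        nlinarith
      have hsq : (√n * w ^ (r - 1)) ^ 2 ≤ 1 := by
        rw [mul_pow, Real.sq_sqrt hn0.le, ← pow_mul]
        have : w ^ ((r - 1) * 2) ≤ w ^ r := pow_le_pow_of_le_one hw0.le hw1 (by omega)
        have := mul_le_mul_of_nonneg_left this hn0.le
        linarith
      have hsq' : √n * w ^ (r - 1) ≤ 1 := by
        have h0 : 0 ≤ √n * w ^ (r - 1) := by positivity
        nlinarith
      have hL : 1 - Real.log p ≤ 2 * √n := by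
        have e : Real.log a = Real.log n + Real.log p := by rw [ha, Real.log_mul hn0.ne' hp0.ne']
        have := Real.log_nonneg hnp
        have := one_add_log_le_two_mul_sqrt hn0
        linarith
      have e3 : lam * a ^ (r - 1) = (lam * τ ^ (r - 1)) * w ^ (r - 1) := by
        rw [hw, div_pow]; field_simp
      rw [e3]
      calc (lam * τ ^ (r - 1)) * w ^ (r - 1) ≤ (η₀ * (2 * √n)) * w ^ (r - 1) := by
            exact mul_le_mul_of_nonneg_right
              (hl2.trans (mul_le_mul_of_nonneg_left hL hη₀)) (by positivity)
        _ = 2 * η₀ * (√n * w ^ (r - 1)) := by ring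
        _ ≤ 2 * η₀ * 1 := by gcongr
        _ ≤ η := by linarith
    -- If τ > n, the gain is p^{r-1} ≤ p, and p log(e/p) ≤ 1.
    · rw [min_eq_right hτn.le] at hl2
      have e3 : lam * a ^ (r - 1) = (lam * (n : ℝ) ^ (r - 1)) * p ^ (r - 1) := by
        rw [ha, mul_pow]; ring
      have e4 : p ^ (r - 1) ≤ p := by
        calc p ^ (r - 1) ≤ p ^ 1 := pow_le_pow_of_le_one hp0.le hp1 (by omega)
          _ = p := pow_one p
      have hlogp : Real.log p ≤ 0 := Real.log_nonpos hp0.le hp1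
      have e5 : (1 - Real.log p) * p ≤ 1 := by
        have := Real.log_le_sub_one_of_pos (inv_pos.2 hp0)
        rw [Real.log_inv] at this
        have h6 := mul_le_mul_of_nonneg_right this hp0.le
        rw [sub_mul, inv_mul_cancel₀ hp0.ne'] at h6
        linarith
      rw [e3]
      calc (lam * (n : ℝ) ^ (r - 1)) * p ^ (r - 1) ≤ (η₀ * (1 - Real.log p)) * p := by
            gcongr
            exact mul_nonneg hη₀ (by linarith)
        _ = η₀ * ((1 - Real.log p) * p) := by ring
        _ ≤ η₀ * 1 := by gcongr
        _ ≤ η := by linarith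

set_option maxHeartbeats 1000000 in
/-- A truncation level for polynomially small expected degree. -/
lemma exists_isTruncation_of_mean_small (r : ℕ) (hr : 2 ≤ r) {η κ : ℝ} (hη : 0 < η) (hκ : 0 < κ)
    (hκ1 : κ ≤ 1) :
    ∃ η₁ : ℝ, 0 < η₁ ∧ ∀ (n : ℕ) (p τ lam η₀ : ℝ), 0 < η₀ → η₀ ≤ η₁ → 3 ≤ n → 0 < p → p ≤ 1 →
      0 < τ → 0 ≤ lam →
      lam * (1 + (n * p) ^ (r - 1)) ≤ η₀ * Real.log (1 + τ ^ r / (κ * (n * (n * p) ^ r))) →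
      lam * (min τ n) ^ (r - 1) ≤ η₀ * (1 - Real.log p) →
      Real.log n < 3 * r * -Real.log (n * p) → ∃ K, IsTruncation η r n p lam (τ ^ r) K := by
  have hr0 : (2 : ℝ) ≤ r := by exact_mod_cast hr
  have hlogκ : 0 ≤ Real.log (2 / κ) := Real.log_nonneg ((one_le_div hκ).2 (by linarith))
  obtain ⟨C₂, hC₂⟩ : ∃ x : ℝ, x = 6 * r + 1 := ⟨_, rfl⟩
  obtain ⟨C₃, hC₃⟩ : ∃ x : ℝ, x = 3 * r * Real.log (2 / κ) + r := ⟨_, rfl⟩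
  have hC₂0 : 0 < C₂ := by rw [hC₂]; positivity
  have hC₃0 : 0 < C₃ := by rw [hC₃]; positivity
  -- With ℓ = -log(np), the regime gives 2 log n < 6rℓ. Chernoff's exponent is at least Kℓ, of which
  -- λt/2 takes at most Kℓ/2; K ≥ 18r leaves 9rℓ for the factor n².
  obtain ⟨K₀, hK₀⟩ : ∃ x : ℝ, x = 18 * r := ⟨_, rfl⟩
  have hK₀1 : 36 ≤ K₀ := by rw [hK₀]; linarith
  have hK₀p : 1 ≤ K₀ ^ (r - 1) := one_le_pow₀ (by linarith)
  obtain ⟨C₄, hC₄⟩ : ∃ x : ℝ, x = K₀ ^ (r - 1) * (C₂ + C₃) := ⟨_, rfl⟩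
  have hC₄0 : 0 < C₄ := by rw [hC₄]; positivity
  refine ⟨min (η / C₄) (1 / C₄), by positivity, ?_⟩
  intro n p τ lam η₀ hη₀ hη₀1 hn hp0 hp1 hτ hlam hl1 hl2 hsmall
  have hη₀η : η₀ * C₄ ≤ η := by
    rw [← le_div_iff₀ hC₄0]; exact hη₀1.trans (min_le_left _ _)
  have hη₀1' : η₀ * C₄ ≤ 1 := by
    rw [← le_div_iff₀ hC₄0]; exact hη₀1.trans (min_le_right _ _)
  have hn3 : (3 : ℝ) ≤ n := by exact_mod_cast hn
  have hn0 : (0 : ℝ) < n := by linarith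
  have hlogn : 1 ≤ Real.log n := one_le_log_three.trans (Real.log_le_log (by norm_num) hn3)
  have hloga : Real.log (n * p) = Real.log n + Real.log p := Real.log_mul hn0.ne' hp0.ne'
  set a : ℝ := n * p with ha
  have ha0 : 0 < a := by positivity
  clear_value a
  obtain ⟨ℓ, hℓ⟩ : ∃ x : ℝ, x = -Real.log a := ⟨_, rfl⟩
  rw [← hℓ] at hsmall
  have hℓ1 : 1 ≤ 3 * r * ℓ := by linarith
  have hℓ0 : 0 < ℓ := by
    by_contra hcon
    push Not at hcon
    have := mul_nonneg (by linarith : (0 : ℝ) ≤ 3 * r) (neg_nonneg.2 hcon)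
    linarith
  have ha1 : a ≤ 1 := by
    by_contra hcon
    push Not at hcon
    have := Real.log_pos hcon
    linarith
  have hL : 1 - Real.log p ≤ C₂ * ℓ := by
    have : 1 - Real.log p = 1 + Real.log n + ℓ := by rw [hℓ, hloga]; ring
    rw [this, hC₂]; linarith
  have hL0 : 0 ≤ 1 - Real.log p := by linarith [Real.log_nonpos hp0.le hp1]
  -- For τ < 1 the factor min(τ, n)^{r-1} may be tiny and the second hypothesis does not bound λ
  -- well. The first does, since its logarithm is O(ℓ).
  have hlamsmall : τ < 1 → lam ≤ η₀ * (C₃ * ℓ) := by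
    intro hτ1
    have hτr : τ ^ r ≤ 1 := pow_le_one₀ hτ.le hτ1.le
    have e1 : 1 + τ ^ r / (κ * (n * a ^ r)) ≤ 2 / (κ * a ^ r) := by
      have har : a ^ r ≤ 1 := pow_le_one₀ ha0.le ha1
      have h1 : τ ^ r / (κ * (n * a ^ r)) ≤ 1 / (κ * a ^ r) := by
        gcongr
        exact le_mul_of_one_le_left (by positivity) (by linarith)
      have h2 : 1 ≤ 1 / (κ * a ^ r) := by
        rw [one_le_div (by positivity)]
        exact mul_le_one₀ hκ1 (by positivity) har
      have h3 : 2 / (κ * a ^ r) = 1 / (κ * a ^ r) + 1 / (κ * a ^ r) := by ring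
      linarith
    have e2 : Real.log (1 + τ ^ r / (κ * (n * a ^ r))) ≤ C₃ * ℓ := by
      refine (Real.log_le_log (by positivity) e1).trans ?_
      have : 2 / (κ * a ^ r) = 2 / κ * (1 / a ^ r) := by field_simp
      rw [this, Real.log_mul (by positivity) (by positivity), Real.log_div one_ne_zero
        (by positivity), Real.log_one, Real.log_pow, hC₃]
      have : Real.log (2 / κ) * 1 ≤ Real.log (2 / κ) * (3 * r * ℓ) := by gcongr
      have e : (0 : ℝ) - r * Real.log a = r * ℓ := by rw [hℓ]; ring
      rw [e]
      linarith
    have e3 : lam ≤ lam * (1 + a ^ (r - 1)) := by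
      have : 0 ≤ lam * a ^ (r - 1) := by positivity
      linarith
    exact e3.trans (hl1.trans (by gcongr))
  -- The scale τ = t^{1/r} is where one degree accounts for about t stars; the constant K₀ covers
  -- small τ and pays for n².
  refine ⟨max K₀ τ, ?_, ?_, ?_⟩
  · exact le_max_of_le_left (by linarith)
  · intro d hd3 _ hdK hdn
    rw [← ha]
    have hd3' : (3 : ℝ) ≤ d := by exact_mod_cast hd3
    have hlogd : ℓ ≤ Real.log (d / a) := by
      rw [Real.log_div (by positivity) ha0.ne', hℓ]
      have := Real.log_nonneg (by linarith : (1 : ℝ) ≤ d)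
      linarith
    have main : lam * (d : ℝ) ^ (r - 1) ≤ K₀ ^ (r - 1) * (η₀ * ((C₂ + C₃) * ℓ)) := by
      rcases le_or_gt 1 τ with hτ1 | hτ1
      · have hdT : (d : ℝ) ≤ K₀ * min τ n := by
          rw [mul_min_of_nonneg _ _ (by linarith)]
          refine le_min ?_ ?_
          · exact hdK.trans (max_le (le_mul_of_one_le_right (by linarith) hτ1)
              (le_mul_of_one_le_left hτ.le (by linarith)))
          · have : (d : ℝ) ≤ n := by
              have : d ≤ n := by omega
              exact_mod_cast this
            exact this.trans (le_mul_of_one_le_left hn0.le (by linarith))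
        have hT0 : 0 ≤ min τ n := le_min hτ.le hn0.le
        calc lam * (d : ℝ) ^ (r - 1) ≤ lam * (K₀ * min τ n) ^ (r - 1) := by gcongr
          _ = K₀ ^ (r - 1) * (lam * (min τ n) ^ (r - 1)) := by rw [mul_pow]; ring
          _ ≤ K₀ ^ (r - 1) * (η₀ * (C₂ * ℓ)) := by
            exact mul_le_mul_of_nonneg_left
              (hl2.trans (mul_le_mul_of_nonneg_left hL hη₀.le)) (by positivity)
          _ ≤ _ := by gcongr; linarith
      · have hdK' : (d : ℝ) ≤ K₀ := by
          rwa [max_eq_left (by linarith)] at hdK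
        calc lam * (d : ℝ) ^ (r - 1) ≤ (η₀ * (C₃ * ℓ)) * K₀ ^ (r - 1) := by
              gcongr; exact hlamsmall hτ1
          _ = K₀ ^ (r - 1) * (η₀ * (C₃ * ℓ)) := by ring
          _ ≤ _ := by gcongr; linarith
    calc lam * (d : ℝ) ^ (r - 1) ≤ K₀ ^ (r - 1) * (η₀ * ((C₂ + C₃) * ℓ)) := main
      _ = (η₀ * C₄) * ℓ := by rw [hC₄]; ring
      _ ≤ η * ℓ := by gcongr
      _ ≤ _ := by gcongr
  · set K := max K₀ τ with hK
    have hKK₀ : K₀ ≤ K := le_max_left _ _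
    have hKτ : τ ≤ K := le_max_right _ _
    clear_value K
    rcases le_or_gt ((n - 1 : ℕ) : ℝ) K with hKn | hKn
    · rw [binExp_indicator_eq_zero hKn, mul_zero]
      exact (Real.exp_pos _).le
    · have hτn : τ ≤ n := by
        have : ((n - 1 : ℕ) : ℝ) ≤ n := by exact_mod_cast Nat.sub_le _ _
        linarith
      have hma : ((n - 1 : ℕ) : ℝ) * p ≤ a := by
        have : ((n - 1 : ℕ) : ℝ) ≤ n := by exact_mod_cast Nat.sub_le _ _
        rw [ha]; gcongr
      have h1 := binExp_tail_le hp0.le hp1 ha0 hma (by linarith : a ≤ K)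
      have hlogK : 1 + ℓ ≤ Real.log (K / a) := by
        rw [Real.log_div (by linarith) ha0.ne', hℓ]
        have := one_le_log_three.trans (Real.log_le_log (by norm_num) (by linarith : 3 ≤ K))
        linarith
      have hC₄' : C₂ + C₃ ≤ C₄ := by
        rw [hC₄]; exact le_mul_of_one_le_left (by positivity) hK₀p
      have hlamτ : lam * τ ^ r ≤ K * ℓ := by
        have hgoal : lam * τ ^ r ≤ K * (η₀ * (C₄ * ℓ)) := by
          rcases le_or_gt 1 τ with hτ1 | hτ1
          · rw [min_eq_left hτn] at hl2
            have e : lam * τ ^ r = τ * (lam * τ ^ (r - 1)) := by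
              have : τ ^ r = τ * τ ^ (r - 1) := by rw [← pow_succ']; congr 1; omega
              rw [this]; ring
            rw [e]
            calc τ * (lam * τ ^ (r - 1)) ≤ K * (η₀ * (C₂ * ℓ)) := by
                  refine mul_le_mul hKτ (hl2.trans (by gcongr)) (by positivity)
                    (by linarith)
              _ ≤ _ := by gcongr <;> linarith
          · calc lam * τ ^ r ≤ lam * 1 := by gcongr; exact pow_le_one₀ hτ.le hτ1.le
              _ ≤ 1 * (η₀ * (C₃ * ℓ)) := by
                rw [mul_one, one_mul]; exact hlamsmall hτ1
              _ ≤ _ := by gcongr <;> linarith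
        calc lam * τ ^ r ≤ K * (η₀ * (C₄ * ℓ)) := hgoal
          _ = K * ℓ * (η₀ * C₄) := by ring
          _ ≤ K * ℓ * 1 := by
            have : 0 ≤ K * ℓ := mul_nonneg (by linarith) hℓ0.le
            gcongr
          _ = _ := mul_one _
      have hn2 : (n : ℝ) ^ 2 = Real.exp (2 * Real.log n) := by
        rw [← Real.log_rpow hn0, Real.exp_log (by positivity)]; norm_cast
      rw [hn2]
      calc _ ≤ Real.exp (2 * Real.log n) * Real.exp (-(K * (Real.log (K / a) - 1))) := by gcongr
        _ = Real.exp (2 * Real.log n - K * (Real.log (K / a) - 1)) := by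
          rw [← Real.exp_add]; ring_nf
        _ ≤ _ := by
          refine Real.exp_le_exp.2 ?_
          have e1 : K * ℓ ≤ K * (Real.log (K / a) - 1) := by
            gcongr <;> linarith
          have e2 : K₀ * ℓ ≤ K * ℓ := by gcongr
          have e3 : K₀ * ℓ = 18 * (r * ℓ) := by rw [hK₀]; ring
          have e4 : 0 ≤ r * ℓ := by positivity
          linarith

/-- A truncation level for bounded `n`. -/
lemma exists_isTruncation_of_bounded (r : ℕ) {η κ N₀ : ℝ} (hη : 0 < η) (hκ : 0 < κ)
    (hN₀ : 1 ≤ N₀) :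
    ∃ η₁ : ℝ, 0 < η₁ ∧ ∀ (n : ℕ) (p τ lam η₀ : ℝ), 0 < η₀ → η₀ ≤ η₁ → 3 ≤ n → 0 < p → p ≤ 1 →
      0 < τ → 0 ≤ lam →
      lam * (1 + (n * p) ^ (r - 1)) ≤ η₀ * Real.log (1 + τ ^ r / (κ * (n * (n * p) ^ r))) →
      lam * (min τ n) ^ (r - 1) ≤ η₀ * (1 - Real.log p) →
      1 ≤ r → 3 * r * -Real.log (n * p) ≤ Real.log n → n ≤ N₀ →
      ∃ K, IsTruncation η r n p lam (τ ^ r) K := by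
  obtain ⟨C, hC⟩ : ∃ x : ℝ, x = (3 * N₀ + 1 / κ) * N₀ ^ (r - 1) := ⟨_, rfl⟩
  have hC0 : 0 < C := by rw [hC]; positivity
  refine ⟨η / C, by positivity, ?_⟩
  intro n p τ lam η₀ hη₀ hη₀1 hn hp0 hp1 hτ hlam hl1 hl2 hr1 hbig hnN
  have hη₀η : η₀ * C ≤ η := by rwa [← le_div_iff₀ hC0]
  have hn3 : (3 : ℝ) ≤ n := by exact_mod_cast hn
  have hn0 : (0 : ℝ) < n := by linarith
  have hr1' : (1 : ℝ) ≤ r := by exact_mod_cast hr1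
  have hlogn : 1 ≤ Real.log n := one_le_log_three.trans (Real.log_le_log (by norm_num) hn3)
  have hlogn' : Real.log n ≤ n := by
    have := Real.log_le_sub_one_of_pos hn0
    linarith
  have hloga : Real.log (n * p) = Real.log n + Real.log p := Real.log_mul hn0.ne' hp0.ne'
  set a : ℝ := n * p with ha
  have ha0 : 0 < a := by positivity
  have hloga' : -Real.log n ≤ r * Real.log a := by nlinarith
  have hlama : lam ≤ η₀ * (3 * N₀ + 1 / κ) := by
    rcases le_or_gt 1 τ with hτ1 | hτ1
    · have hT : 1 ≤ min τ n := le_min hτ1 (by linarith)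
      have hT' : 1 ≤ (min τ n) ^ (r - 1) := one_le_pow₀ hT
      have hL : 1 - Real.log p ≤ 3 * N₀ + 1 / κ := by
        have h0 : -Real.log a ≤ Real.log n := by
          by_contra hcon
          push Not at hcon
          nlinarith
        have : 0 < 1 / κ := by positivity
        linarith
      calc lam ≤ lam * (min τ n) ^ (r - 1) := le_mul_of_one_le_right hlam hT'
        _ ≤ η₀ * (1 - Real.log p) := hl2
        _ ≤ _ := by gcongr
    · have hna : 1 ≤ n * a ^ r := by
        rw [← Real.log_nonneg_iff (by positivity), Real.log_mul hn0.ne' (by positivity),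
          Real.log_pow]
        linarith
      have hτr : τ ^ r ≤ 1 := pow_le_one₀ hτ.le hτ1.le
      have e1 : τ ^ r / (κ * (n * a ^ r)) ≤ 1 / κ := by
        rw [div_le_div_iff₀ (by positivity) hκ]
        nlinarith
      have e3 : lam ≤ lam * (1 + a ^ (r - 1)) := by
        have : 0 ≤ lam * a ^ (r - 1) := by positivity
        linarith
      calc lam ≤ _ := e3
        _ ≤ η₀ * Real.log (1 + τ ^ r / (κ * (n * a ^ r))) := hl1
        _ ≤ η₀ * (1 / κ) := by
          gcongr; exact (log_one_add_le_self (by positivity)).trans e1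
        _ ≤ _ := by gcongr; linarith
  -- No degree exceeds n-1, so the tail vanishes. For growth, λ and d are bounded in terms of N₀,
  -- while log(d/(np)) ≥ log 3 ≥ 1.
  refine ⟨n, ?_, ?_, ?_⟩
  · rw [← ha, ha]; nlinarith
  · intro d hd3 hda hdK _
    have hd3' : (3 : ℝ) ≤ d := by exact_mod_cast hd3
    have hlogd : 1 ≤ Real.log (d / a) := by
      refine one_le_log_three.trans (Real.log_le_log (by norm_num) ?_)
      rw [le_div_iff₀ ha0]; exact hda
    calc lam * (d : ℝ) ^ (r - 1) ≤ (η₀ * (3 * N₀ + 1 / κ)) * N₀ ^ (r - 1) := by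
          gcongr; exact hdK.trans hnN
      _ = η₀ * C := by rw [hC]; ring
      _ ≤ η * 1 := by linarith
      _ ≤ _ := by gcongr
  · rw [binExp_indicator_eq_zero (by exact_mod_cast Nat.sub_le _ _), mul_zero]
    exact (Real.exp_pos _).le

/-- A bound at the top level T passes down to every d in [3h, T]. With z = T/d, the left side
shrinks by z^{-(r-1)} ≤ 1/z, while the logarithm drops only by log z ≤ z - 1. -/
lemma mul_pow_le_mul_log_div {r : ℕ} (hr : 2 ≤ r) {T h d L C lam η₀ : ℝ} (hh : 0 < h)
    (hhd : 3 * h ≤ d) (hdT : d ≤ T) (hη₀ : 0 ≤ η₀) (hC : 0 ≤ C)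
    (hl : lam * T ^ (r - 1) ≤ η₀ * L) (hL : L ≤ C * (1 + Real.log (T / h))) :
    lam * d ^ (r - 1) ≤ 2 * η₀ * C * Real.log (d / h) := by
  have hd0 : 0 < d := by linarith
  have hT0 : 0 < T := by linarith
  set z : ℝ := T / d with hz
  have hz1 : 1 ≤ z := (one_le_div hd0).2 hdT
  have hz0 : 0 < z := by linarith
  have hlogd : 1 ≤ Real.log (d / h) := by
    refine one_le_log_three.trans (Real.log_le_log (by norm_num) ?_)
    rw [le_div_iff₀ hh]; exact hhd
  have hlogT : Real.log (T / h) = Real.log (d / h) + Real.log z := by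
    rw [← Real.log_mul (by positivity) (by positivity), hz]
    congr 1; field_simp
  have hlogz : Real.log z ≤ z - 1 := Real.log_le_sub_one_of_pos hz0
  have hlogz0 : 0 ≤ Real.log z := Real.log_nonneg hz1
  have key : 1 / z * (1 + Real.log (T / h)) ≤ 2 * Real.log (d / h) := by
    rw [hlogT, one_div, inv_mul_le_iff₀ hz0]
    have : 1 * Real.log (d / h) ≤ z * Real.log (d / h) := by gcongr
    have : z * 1 ≤ z * Real.log (d / h) := by gcongr
    linarith
  have hw : (1 / z) ^ (r - 1) ≤ 1 / z := by
    calc (1 / z) ^ (r - 1) ≤ (1 / z) ^ 1 :=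
          pow_le_pow_of_le_one (by positivity) ((div_le_one hz0).2 hz1) (by omega)
      _ = 1 / z := pow_one _
  have e : lam * d ^ (r - 1) = (lam * T ^ (r - 1)) * (1 / z) ^ (r - 1) := by
    rw [mul_assoc, ← mul_pow, hz]
    congr 2; field_simp
  rw [e]
  calc (lam * T ^ (r - 1)) * (1 / z) ^ (r - 1)
      ≤ (η₀ * (C * (1 + Real.log (T / h)))) * (1 / z) ^ (r - 1) := by
        refine mul_le_mul_of_nonneg_right (hl.trans ?_) (by positivity)
        gcongr
    _ ≤ (η₀ * (C * (1 + Real.log (T / h)))) * (1 / z) := by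
        have : 0 ≤ 1 + Real.log (T / h) := by linarith
        gcongr
    _ = η₀ * C * (1 / z * (1 + Real.log (T / h))) := by ring
    _ ≤ η₀ * C * (2 * Real.log (d / h)) := by gcongr
    _ = _ := by ring

/-- In the range `t ≤ (hN)^r`, with `h = max (np) 1`, the exponent is tiny. -/
lemma mul_pow_le_of_small_deviation {r : ℕ} (hr : 1 ≤ r) {N a h τ lam η₀ κ n : ℝ} (hN : 1 ≤ N)
    (hn : n = N ^ (3 * r)) (ha : 0 < a) (hh : 1 ≤ h) (hhN : h ≤ a * N)
    (hh1 : h ^ (r - 1) ≤ 1 + a ^ (r - 1)) (hκ : 0 < κ) (hη₀ : 0 ≤ η₀) (hlam : 0 ≤ lam)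
    (hτ0 : 0 ≤ τ) (hτ : τ ≤ h * N)
    (hl1 : lam * (1 + a ^ (r - 1)) ≤ η₀ * Real.log (1 + τ ^ r / (κ * (n * a ^ r)))) :
    lam * (h * N) ^ (r - 1) ≤ η₀ / κ ∧ lam * τ ^ r ≤ η₀ / κ * h := by
  have hN0 : 0 < N := by linarith
  -- From τ ≤ hN ≤ aN² one gets τ^r ≤ a^r N^{2r}; dividing by n = N^{3r} leaves N^{-r}.
  have hX : τ ^ r / (κ * (n * a ^ r)) ≤ 1 / (κ * N ^ r) := by
    rw [hn, div_le_div_iff₀ (by positivity) (by positivity)]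
    have h1 : τ ^ r ≤ (a * N * N) ^ r := by
      refine pow_le_pow_left₀ hτ0 (hτ.trans ?_) r
      gcongr
    calc τ ^ r * (κ * N ^ r) ≤ (a * N * N) ^ r * (κ * N ^ r) := by gcongr
      _ = 1 * (κ * (N ^ (3 * r) * a ^ r)) := by rw [pow_mul, mul_pow, mul_pow, ← pow_mul]; ring
  have hlamh : lam * h ^ (r - 1) ≤ η₀ / (κ * N ^ r) := by
    calc lam * h ^ (r - 1) ≤ lam * (1 + a ^ (r - 1)) := by gcongr
      _ ≤ η₀ * Real.log (1 + τ ^ r / (κ * (n * a ^ r))) := hl1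
      _ ≤ η₀ * (1 / (κ * N ^ r)) := by
        gcongr
        refine (log_one_add_le_self ?_).trans hX
        rw [hn]; positivity
      _ = _ := by ring
  have hNr : N ^ (r - 1) ≤ N ^ r := pow_le_pow_right₀ hN (by omega)
  constructor
  · calc lam * (h * N) ^ (r - 1) = (lam * h ^ (r - 1)) * N ^ (r - 1) := by rw [mul_pow]; ring
      _ ≤ η₀ / (κ * N ^ r) * N ^ r := by gcongr
      _ = η₀ / κ := by field_simp
  · calc lam * τ ^ r ≤ lam * (h * N) ^ r := by gcongr
      _ = (lam * h ^ (r - 1)) * (h * N ^ r) := by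
        have : h ^ r = h ^ (r - 1) * h := by rw [← pow_succ]; congr 1; omega
        rw [mul_pow, this]; ring
      _ ≤ η₀ / (κ * N ^ r) * (h * N ^ r) := by gcongr
      _ = _ := by field_simp

/-- Supplies the hypothesis on L in `mul_pow_le_mul_log_div` for L = log(e/p) = 1 + log n - log a.
If T = n and a ≥ 1, then T/h is exactly 1/p. If T ≥ hN, then log(T/h) ≥ log N, and both log n and
-log a are bounded by multiples of log N. -/
lemma one_sub_log_le {T h a n N p C : ℝ} (hC : 3 ≤ C) (hn : 1 ≤ n) (hN : 1 ≤ N) (ha : 0 < a)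
    (hp : p ≤ 1) (hp0 : 0 < p) (hanp : a = n * p) (hh : h = max a 1)
    (hlogn : Real.log n ≤ (C - 2) * Real.log N) (hNn : Real.log N ≤ Real.log n)
    (hloga : -Real.log a ≤ Real.log N)
    (hT : T = n ∨ h * N ≤ T) : 1 - Real.log p ≤ C * (1 + Real.log (T / h)) := by
  have hh0 : 0 < h := by rw [hh]; exact lt_max_of_lt_left ha
  have hn0 : 0 < n := by linarith
  have hlogN : 0 ≤ Real.log N := Real.log_nonneg hN
  have e : Real.log p = Real.log a - Real.log n := by
    rw [hanp, Real.log_mul hn0.ne' hp0.ne']; ring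
  rcases hT with rfl | hT
  · rw [Real.log_div hn0.ne' hh0.ne', e]
    have hp' : Real.log p ≤ 0 := Real.log_nonpos hp0.le hp
    rcases le_total 1 a with h1 | h1
    · rw [hh, max_eq_left h1]
      have h2 : 0 ≤ 1 + (Real.log T - Real.log a) := by linarith
      have := mul_le_mul_of_nonneg_right (by linarith : 1 ≤ C) h2
      linarith
    · rw [hh, max_eq_right h1, Real.log_one]
      have h2 : 0 ≤ 1 + (Real.log T - 0) := by linarith [Real.log_nonneg hn]
      have := mul_le_mul_of_nonneg_right (by linarith : 2 ≤ C) h2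
      linarith
  · have h1 : Real.log N ≤ Real.log (T / h) := by
      refine Real.log_le_log (by linarith) ?_
      rw [le_div_iff₀ hh0]; linarith
    have h2 : C * (1 + Real.log N) ≤ C * (1 + Real.log (T / h)) := by gcongr
    rw [e]
    linarith

set_option maxHeartbeats 1000000 in
/-- A truncation level for large `n` when the expected degree is not too small. -/
lemma exists_isTruncation_of_large (r : ℕ) (hr : 2 ≤ r) {η κ : ℝ} (hη : 0 < η) (hκ : 0 < κ) :
    ∃ η₁ N₀ : ℝ, 0 < η₁ ∧ 1 ≤ N₀ ∧ ∀ (n : ℕ) (p τ lam η₀ : ℝ), 0 < η₀ → η₀ ≤ η₁ → 3 ≤ n →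
      0 < p → p ≤ 1 → 0 < τ → 0 ≤ lam →
      lam * (1 + (n * p) ^ (r - 1)) ≤ η₀ * Real.log (1 + τ ^ r / (κ * (n * (n * p) ^ r))) →
      lam * (min τ n) ^ (r - 1) ≤ η₀ * (1 - Real.log p) →
      3 * r * -Real.log (n * p) ≤ Real.log n → N₀ ≤ n →
      ∃ K, IsTruncation η r n p lam (τ ^ r) K := by
  have hr0 : (2 : ℝ) ≤ r := by exact_mod_cast hr
  -- N ≥ M gives log N ≥ 4, so that the -1 in Chernoff's exponent costs at most a quarter, and N ≥
  -- 24r, so that n² = exp(6r log N) costs at most another quarter.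
  obtain ⟨M, hM⟩ : ∃ x : ℝ, x = max (Real.exp 4) (24 * r) := ⟨_, rfl⟩
  have hM1 : Real.exp 4 ≤ M := by rw [hM]; exact le_max_left _ _
  have hM2 : 24 * r ≤ M := by rw [hM]; exact le_max_right _ _
  have hM0 : 1 ≤ M := by linarith
  obtain ⟨C, hC⟩ : ∃ x : ℝ, x = 3 * r + 2 := ⟨_, rfl⟩
  have hC0 : 0 < C := by rw [hC]; positivity
  refine ⟨min (min (η / (2 * C)) (η * κ)) (min (1 / (4 * C)) (κ / 4)), M ^ (3 * r), by positivity,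
    one_le_pow₀ hM0, ?_⟩
  intro n p τ lam η₀ hη₀ hη₀1 hn hp0 hp1 hτ hlam hl1 hl2 hbig hnM
  have hb1 : η₀ * (2 * C) ≤ η := by
    rw [← le_div_iff₀ (by positivity)]
    exact hη₀1.trans ((min_le_left _ _).trans (min_le_left _ _))
  have hb2 : η₀ / κ ≤ η := by
    rw [div_le_iff₀ hκ]
    exact hη₀1.trans ((min_le_left _ _).trans (min_le_right _ _))
  have hb3 : η₀ * (4 * C) ≤ 1 := by
    rw [← le_div_iff₀ (by positivity)]
    exact hη₀1.trans ((min_le_right _ _).trans (min_le_left _ _))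
  have hb4 : η₀ / κ ≤ 1 / 4 := by
    rw [div_le_iff₀ hκ]
    refine hη₀1.trans ((min_le_right _ _).trans ((min_le_right _ _).trans (le_of_eq ?_)))
    ring
  clear hη₀1
  have hn3 : (3 : ℝ) ≤ n := by exact_mod_cast hn
  have hn0 : (0 : ℝ) < n := by linarith
  -- With n = N^{3r} the regime reads np ≥ 1/N, and the mean is compared with h = max(np, 1) below.
  obtain ⟨N, hN⟩ : ∃ x : ℝ, x = (n : ℝ) ^ (1 / (3 * r : ℝ)) := ⟨_, rfl⟩
  have hN0 : 0 < N := by rw [hN]; positivity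
  have hNn : (n : ℝ) = N ^ (3 * r) := by
    rw [hN, ← Real.rpow_natCast, ← Real.rpow_mul hn0.le]
    push_cast
    rw [one_div_mul_cancel (by positivity), Real.rpow_one]
  have hMN : M ≤ N := by
    rw [hNn] at hnM
    exact le_of_pow_le_pow_left₀ (by omega) hN0.le hnM
  have hlogN : 4 ≤ Real.log N := by
    rw [Real.le_log_iff_exp_le hN0]; linarith
  have hN1 : 1 ≤ N := by linarith
  have hlogn : Real.log n = 3 * r * Real.log N := by
    rw [hNn, Real.log_pow]; push_cast; ring
  set a : ℝ := n * p with ha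
  have ha0 : 0 < a := by positivity
  clear_value a
  have hloga : -Real.log a ≤ Real.log N := by
    rw [hlogn] at hbig
    exact le_of_mul_le_mul_left hbig (by positivity)
  obtain ⟨h, hh⟩ : ∃ x : ℝ, x = max a 1 := ⟨_, rfl⟩
  have hh1 : 1 ≤ h := by rw [hh]; exact le_max_right _ _
  have hah : a ≤ h := by rw [hh]; exact le_max_left _ _
  have haN : 1 ≤ a * N := by
    rw [← Real.log_nonneg_iff (by positivity), Real.log_mul ha0.ne' hN0.ne']
    linarith
  have hhN : h ≤ a * N := by
    rw [hh]
    exact max_le (le_mul_of_one_le_right ha0.le hN1) haN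
  have hhpow : h ^ (r - 1) ≤ 1 + a ^ (r - 1) := by
    rw [hh]
    rcases le_total 1 a with h1 | h1
    · rw [max_eq_left h1]; linarith
    · rw [max_eq_right h1, one_pow]
      have : 0 ≤ a ^ (r - 1) := by positivity
      linarith
  have hlogNn : Real.log N ≤ Real.log n := by
    rw [hlogn]
    exact le_mul_of_one_le_left (by linarith) (by linarith)
  have hLT : ∀ T : ℝ, (T = n ∨ h * N ≤ T) → 1 - Real.log p ≤ C * (1 + Real.log (T / h)) := by
    intro T hT
    refine one_sub_log_le (by rw [hC]; linarith) (by linarith) hN1 ha0 hp1 hp0 ha hh ?_ hlogNn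
      hloga hT
    rw [hlogn, hC]; apply le_of_eq; ring
  have hL : 1 - Real.log p ≤ C * Real.log N := by
    have : Real.log a = Real.log n + Real.log p := by
      rw [ha, Real.log_mul hn0.ne' hp0.ne']
    have e : C * Real.log N = 3 * r * Real.log N + 2 * Real.log N := by rw [hC]; ring
    rw [e]
    linarith
  have hsmall : τ ≤ h * N → lam * (h * N) ^ (r - 1) ≤ η₀ / κ ∧ lam * τ ^ r ≤ η₀ / κ * h :=
    fun hc => mul_pow_le_of_small_deviation (by omega) hN1 hNn ha0 hh1 hhN hhpow hκ hη₀.le hlam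
      hτ.le hc hl1
  -- The level hN exceeds the mean scale by a power of n, which gives Chernoff's exponent a factor
  -- log N. If τ lies below it, λ is so small that raising K from τ to hN is harmless (`hsmall`).
  obtain ⟨K, hK⟩ : ∃ x : ℝ, x = max τ (h * N) := ⟨_, rfl⟩
  have hKτ : τ ≤ K := by rw [hK]; exact le_max_left _ _
  have hKh : h * N ≤ K := by rw [hK]; exact le_max_right _ _
  have hhhN : h ≤ h * N := le_mul_of_one_le_right (by linarith) hN1
  have hNhN : N ≤ h * N := le_mul_of_one_le_left hN0.le hh1
  refine ⟨K, ?_, ?_, ?_⟩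
  · rw [← ha]; linarith
  · intro d hd3 hda hdK hdn
    rw [← ha] at hda ⊢
    have hd3' : (3 : ℝ) ≤ d := by exact_mod_cast hd3
    have hhd : 3 * h ≤ d := by
      rw [hh]
      rcases le_total 1 a with h1 | h1
      · rwa [max_eq_left h1]
      · rw [max_eq_right h1]; linarith
    have hdn' : (d : ℝ) ≤ n := by
      have : d ≤ n := by omega
      exact_mod_cast this
    have hlogd : 1 ≤ Real.log (d / h) := by
      refine one_le_log_three.trans (Real.log_le_log (by norm_num) ?_)
      rw [le_div_iff₀ (by linarith)]; exact hhd
    have hlogda : Real.log (d / h) ≤ Real.log (d / a) := by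
      refine Real.log_le_log (div_pos (by linarith) (by linarith)) ?_
      gcongr
    refine le_trans ?_ (mul_le_mul_of_nonneg_left hlogda hη.le)
    rcases le_or_gt (h * N) τ with hc | hc
    · rw [hK, max_eq_left hc] at hdK
      have hT : min τ n = n ∨ h * N ≤ min τ n := by
        rcases le_total τ n with h1 | h1
        · right; rwa [min_eq_left h1]
        · left; rw [min_eq_right h1]
      have := mul_pow_le_mul_log_div hr (by linarith) hhd (le_min hdK hdn') hη₀.le hC0.le hl2
        (hLT _ hT)
      refine this.trans ?_
      gcongr
      linarith
    · rw [hK, max_eq_right hc.le] at hdK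
      calc lam * (d : ℝ) ^ (r - 1) ≤ lam * (h * N) ^ (r - 1) := by gcongr
        _ ≤ η₀ / κ := (hsmall hc.le).1
        _ ≤ η * 1 := by linarith
        _ ≤ _ := by gcongr
  · rcases le_or_gt ((n - 1 : ℕ) : ℝ) K with hKn | hKn
    · rw [binExp_indicator_eq_zero hKn, mul_zero]
      exact (Real.exp_pos _).le
    · have hnn : ((n - 1 : ℕ) : ℝ) ≤ n := by exact_mod_cast Nat.sub_le _ _
      have hτn : τ ≤ n := by linarith
      have hmh : ((n - 1 : ℕ) : ℝ) * p ≤ h := by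
        refine le_trans ?_ hah
        rw [ha]; gcongr
      have h1 := binExp_tail_le hp0.le hp1 (by linarith : 0 < h) hmh (by linarith : h ≤ K)
      have hlogK : Real.log N ≤ Real.log (K / h) := by
        refine Real.log_le_log hN0 ?_
        rw [le_div_iff₀ (by linarith)]; linarith
      have hK0 : 0 < K := by linarith
      have hlamτ : lam * τ ^ r ≤ K * Real.log N / 4 := by
        rcases le_or_gt (h * N) τ with hc | hc
        · rw [min_eq_left hτn] at hl2
          have e : lam * τ ^ r = τ * (lam * τ ^ (r - 1)) := by
            have : τ ^ r = τ * τ ^ (r - 1) := by rw [← pow_succ']; congr 1; omega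
            rw [this]; ring
          rw [e]
          calc τ * (lam * τ ^ (r - 1)) ≤ K * (η₀ * (C * Real.log N)) := by
                refine mul_le_mul hKτ (hl2.trans (mul_le_mul_of_nonneg_left hL hη₀.le))
                  (by positivity) hK0.le
            _ = K * Real.log N / 4 * (η₀ * (4 * C)) := by ring
            _ ≤ K * Real.log N / 4 * 1 := by
              have : 0 ≤ K * Real.log N / 4 := by
                have : 0 ≤ Real.log N := by linarith
                positivity
              gcongr
            _ = _ := mul_one _
        · calc lam * τ ^ r ≤ η₀ / κ * h := (hsmall hc.le).2
            _ ≤ 1 / 4 * K := by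
              refine mul_le_mul hb4 (by linarith) (by linarith) (by norm_num)
            _ ≤ K * Real.log N / 4 := by
              have : K * 1 ≤ K * Real.log N := by
                gcongr; linarith
              linarith
      have hn2 : (n : ℝ) ^ 2 = Real.exp (2 * Real.log n) := by
        rw [← Real.log_rpow hn0, Real.exp_log (by positivity)]; norm_cast
      rw [hn2]
      calc _ ≤ Real.exp (2 * Real.log n) * Real.exp (-(K * (Real.log (K / h) - 1))) := by gcongr
        _ = Real.exp (2 * Real.log n - K * (Real.log (K / h) - 1)) := by
          rw [← Real.exp_add]; ring_nf
        _ ≤ _ := by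
          refine Real.exp_le_exp.2 ?_
          have e1 : K * (Real.log N - 1) ≤ K * (Real.log (K / h) - 1) := by
            gcongr
          have e2 : K * 4 ≤ K * Real.log N := by gcongr
          have e3 : 24 * r * Real.log N ≤ K * Real.log N := by
            gcongr; linarith
          rw [hlogn]
          linarith

/-! ### Choice of the exponential parameter and conclusion -/

lemma phi_nonneg {x : ℝ} (hx : 0 ≤ x) : 0 ≤ phi x := by
  have h0 : 0 < 1 + x := by linarith
  have h := mul_le_mul_of_nonneg_left (Real.one_sub_inv_le_log_of_pos h0) h0.le
  rw [mul_sub, mul_inv_cancel₀ h0.ne'] at h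
  unfold phi
  linarith

lemma phi_le_mul_log {x : ℝ} (hx : 0 ≤ x) : phi x ≤ x * Real.log (1 + x) := by
  have := log_one_add_le_self hx
  unfold phi
  linarith

lemma starUpperTail_eq_zero {r n : ℕ} (hr : 2 ≤ r) (hn : n ≤ r) (p : unitInterval) {x : ℝ}
    (hx : 0 < x) : starUpperTail r n p x = 0 := by
  classical
  have h : {G : SimpleGraph (Fin n) | x ≤ (starCount r G : ℝ)} = ∅ := by
    ext G
    have : starCount r G = 0 := by
      rw [starCount_eq_sum_choose_degree hr]
      refine Finset.sum_eq_zero fun v _ => Nat.choose_eq_zero_of_lt ?_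
      have := G.degree_lt_card_verts v
      rw [Fintype.card_fin] at this
      omega
    simp [this, hx]
  rw [starUpperTail, h]
  simp

/-- M is t/min(t^{1/r}, n)^{r-1} written as a maximum. This turns the bound of the exponent by M
log(e/p) into a bound on λ min(t^{1/r}, n)^{r-1}. -/
lemma clusterM_mul_min_pow_le {r : ℕ} (hr : 1 ≤ r) {n : ℕ} (hn : 0 < n) {t : ℝ} (ht : 0 < t) :
    clusterM r n t * (min (t ^ (1 / (r : ℝ))) n) ^ (r - 1) ≤ t := by
  have hn0 : (0 : ℝ) < n := by exact_mod_cast hn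
  have hr0 : (r : ℝ) ≠ 0 := by
    have : r ≠ 0 := by omega
    exact_mod_cast this
  set τ : ℝ := t ^ (1 / (r : ℝ)) with hτ
  have hτ0 : 0 < τ := by positivity
  have hτr : τ * τ ^ (r - 1) = t := by
    rw [← pow_succ', Nat.sub_add_cancel hr, hτ, ← Real.rpow_natCast, ← Real.rpow_mul ht.le,
      one_div_mul_cancel hr0, Real.rpow_one]
  have hT0 : 0 ≤ min τ (n : ℝ) := le_min hτ0.le hn0.le
  rw [clusterM, ← hτ, max_mul_of_nonneg _ _ (by positivity)]
  refine max_le ?_ ?_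
  · calc τ * (min τ (n : ℝ)) ^ (r - 1) ≤ τ * τ ^ (r - 1) := by
          gcongr; exact min_le_left _ _
      _ = t := hτr
  · calc t / (n : ℝ) ^ (r - 1) * (min τ (n : ℝ)) ^ (r - 1)
        ≤ t / (n : ℝ) ^ (r - 1) * (n : ℝ) ^ (r - 1) := by
          gcongr; exact min_le_right _ _
      _ = t := by field_simp

/-- The regimes are separated by comparing np with n^{-1/(3r)}. Above that threshold, n is either
large or at most the constant N₀ that the argument for large n requires. -/
lemma exists_isTruncation (r : ℕ) (hr : 2 ≤ r) {η κ : ℝ} (hη : 0 < η) (hκ : 0 < κ)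
    (hκ1 : κ ≤ 1) :
    ∃ η₁ : ℝ, 0 < η₁ ∧ ∀ (n : ℕ) (p τ lam η₀ : ℝ), 0 < η₀ → η₀ ≤ η₁ → 3 ≤ n →
      0 < p → p ≤ 1 → 0 < τ → 0 ≤ lam →
      lam * (1 + (n * p) ^ (r - 1)) ≤ η₀ * Real.log (1 + τ ^ r / (κ * (n * (n * p) ^ r))) →
      lam * (min τ n) ^ (r - 1) ≤ η₀ * (1 - Real.log p) →
      ∃ K, IsTruncation η r n p lam (τ ^ r) K := by
  obtain ⟨η₁, hη₁, h1⟩ := exists_isTruncation_of_mean_small r hr hη hκ hκ1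
  obtain ⟨η₂, N₀, hη₂, hN₀, h2⟩ := exists_isTruncation_of_large r hr hη hκ
  obtain ⟨η₃, hη₃, h3⟩ := exists_isTruncation_of_bounded r hη hκ hN₀
  refine ⟨min η₁ (min η₂ η₃), by positivity, ?_⟩
  intro n p τ lam η₀ hη₀ hle hn hp0 hp1 hτ hlam hl1 hl2
  have i1 : η₀ ≤ η₁ := hle.trans (min_le_left _ _)
  have i2 : η₀ ≤ η₂ := hle.trans ((min_le_right _ _).trans (min_le_left _ _))
  have i3 : η₀ ≤ η₃ := hle.trans ((min_le_right _ _).trans (min_le_right _ _))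
  rcases lt_or_ge (Real.log n) (3 * r * -Real.log (n * p)) with hc | hc
  · exact h1 n p τ lam η₀ hη₀ i1 hn hp0 hp1 hτ hlam hl1 hl2 hc
  · rcases le_total N₀ n with hN | hN
    · exact h2 n p τ lam η₀ hη₀ i2 hn hp0 hp1 hτ hlam hl1 hl2 hc hN
    · exact h3 n p τ lam η₀ hη₀ i3 hn hp0 hp1 hτ hlam hl1 hl2 (by omega) hc hN

/-- With a good truncation level, the upper tail of the number of stars decays exponentially. -/
lemma exists_starUpperTail_le_of_isTruncation (r : ℕ) (hr : 2 ≤ r) : ∃ η : ℝ, 0 < η ∧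
    ∀ (n : ℕ) (p : unitInterval) (t lam K : ℝ), r + 1 ≤ n → 0 < (p : ℝ) → 0 < t → 0 ≤ lam →
      lam * (1 + (n * (p : ℝ)) ^ (r - 1)) ≤ η * Real.log (1 + t / starMean r n p) →
      (1 ≤ n * (p : ℝ) → lam * (n * (p : ℝ)) ^ (r - 1) ≤ η) →
      IsTruncation η r n p lam t K →
      starUpperTail r n p (starMean r n p + t) ≤
        (1 + (n : ℝ)⁻¹) * Real.exp (-(lam * t / 2)) := by
  obtain ⟨η₁, hη₁, hsparse⟩ := exists_mgf_le_of_sparse r hr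
  obtain ⟨η₂, hη₂, hdense⟩ := exists_mgf_le_of_dense r hr
  refine ⟨min η₁ η₂, by positivity, ?_⟩
  intro n p t lam K hn hp0 ht hlam hl1 hd hK
  have hη1 : min η₁ η₂ ≤ η₁ := min_le_left _ _
  have hη2 : min η₁ η₂ ≤ η₂ := min_le_right _ _
  have hp1 : (p : ℝ) ≤ 1 := p.2.2
  have hn0 : (0 : ℝ) < n := by
    have : 0 < n := by omega
    exact_mod_cast this
  have hμ := starMean_eq hr n p
  have hch : (0 : ℝ) < (n - 1).choose r := by
    exact_mod_cast Nat.choose_pos (by omega)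
  have hμ0 : 0 < starMean r n p := by rw [hμ]; positivity
  have hx0 : 0 < t / starMean r n p := by positivity
  have hlog : 0 ≤ Real.log (1 + t / starMean r n p) := Real.log_nonneg (by linarith)
  have hgrow : ∀ η' : ℝ, min η₁ η₂ ≤ η' → ∀ d : ℕ, 3 ≤ d → 3 * (n * (p : ℝ)) ≤ d → (d : ℝ) ≤ K →
      d ≤ n - 1 → lam * (d : ℝ) ^ (r - 1) ≤ η' * Real.log (d / (n * (p : ℝ))) := by
    intro η' hη' d h3 h3' hdK hdn
    have ha0 : 0 < n * (p : ℝ) := by positivity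
    have : 0 ≤ Real.log (d / (n * (p : ℝ))) :=
      Real.log_nonneg ((one_le_div ha0).2 (by linarith))
    exact (hK.growth d h3 h3' hdK hdn).trans (mul_le_mul_of_nonneg_right hη' this)
  have hmgf : binExp (p : ℝ) (n - 1)
      (fun d => Real.exp (2 * (lam * if (d : ℝ) ≤ K then (d.choose r : ℝ) else 0))) ≤
      Real.exp (2 * lam * ((n - 1).choose r * (p : ℝ) ^ r) + lam * t / n) := by
    rcases le_total (n * (p : ℝ)) 1 with ha | ha
    · refine hsparse n p K lam t hn hp0 hp1 ha hlam ht ?_ ?_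
      · rw [← hμ]
        have : lam ≤ lam * (1 + (n * (p : ℝ)) ^ (r - 1)) :=
          le_mul_of_one_le_right hlam (by simp; positivity)
        exact this.trans (hl1.trans (mul_le_mul_of_nonneg_right hη1 hlog))
      · intro d h3 hdK hdn
        have : (3 : ℝ) ≤ d := by exact_mod_cast h3
        exact hgrow _ hη1 d h3 (by linarith) hdK hdn
    · refine hdense n p K lam t hn hp0 hp1 ha hlam ht ?_ ((hd ha).trans hη2) hK.mean_le ?_
      · rw [← hμ]
        exact hl1.trans (mul_le_mul_of_nonneg_right hη2 hlog)
      · intro d h8 hdK hdn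
        have : (3 : ℝ) ≤ d := by linarith
        exact hgrow _ hη2 d (by exact_mod_cast this) (by linarith) hdK hdn
  refine (starUpperTail_le hr n p _ K hlam hmgf).trans ?_
  have e1 : n * (2 * lam * ((n - 1).choose r * (p : ℝ) ^ r) + lam * t / n) / 2 -
      lam * (starMean r n p + t) = -(lam * t / 2) := by
    rw [hμ]; field_simp; ring
  rw [e1]
  -- Of the two factors n in `IsTruncation.tail`, one pays for the union bound and the other becomes
  -- the n⁻¹ of the conclusion.
  have e2 : n * binExp (p : ℝ) (n - 1) (fun d => if K < (d : ℝ) then 1 else 0) ≤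
      (n : ℝ)⁻¹ * Real.exp (-(lam * t / 2)) := by
    rw [← div_eq_inv_mul, le_div_iff₀ hn0]
    have := hK.tail
    linarith
  linarith

/-- The upper tail bound for stars, with no restriction on `p` and `t`. -/
theorem exists_starUpperTail_le (r : ℕ) (hr : 2 ≤ r) :
    ∃ c : ℝ, 0 < c ∧ ∀ (n : ℕ) (p : unitInterval) (t : ℝ), 0 < (p : ℝ) → 0 < t →
      starUpperTail r n p (starMean r n p + t) ≤
        (1 + (n : ℝ)⁻¹) *
          Real.exp (-(c *
            min (phi (t / starMean r n p) * starMean r n p ^ 2 / starLambda r n p)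
              (clusterM r n t * Real.log (Real.exp 1 / (p : ℝ))))) := by
  obtain ⟨η, hη, hmain⟩ := exists_starUpperTail_le_of_isTruncation r hr
  have hκ := chooseRatio_pos r
  have hκ1 := chooseRatio_le_one r
  obtain ⟨κ, hκdef⟩ : ∃ x, x = chooseRatio r := ⟨_, rfl⟩
  rw [← hκdef] at hκ hκ1
  obtain ⟨η₁, hη₁, htrunc⟩ := exists_isTruncation r hr hη hκ hκ1
  obtain ⟨η₀, hη₀def⟩ : ∃ x, x = min η₁ (min (η * κ) (η / 2)) := ⟨_, rfl⟩
  have hη₀ : 0 < η₀ := by rw [hη₀def]; positivity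
  have i1 : η₀ ≤ η₁ := by rw [hη₀def]; exact min_le_left _ _
  have i2 : η₀ ≤ η * κ := by
    rw [hη₀def]; exact (min_le_right _ _).trans (min_le_left _ _)
  have i3 : η₀ ≤ η / 2 := by
    rw [hη₀def]; exact (min_le_right _ _).trans (min_le_right _ _)
  refine ⟨η₀ / 2, by positivity, ?_⟩
  intro n p t hp0 ht
  have hp1 : (p : ℝ) ≤ 1 := p.2.2
  rcases le_or_gt n r with hnr | hnr
  · have hμ : 0 ≤ starMean r n p := by rw [starMean_eq hr]; positivity
    rw [starUpperTail_eq_zero hr hnr p (by linarith)]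
    positivity
  have hn : 0 < n := by omega
  have hn0 : (0 : ℝ) < n := by exact_mod_cast hn
  have hr0 : (r : ℝ) ≠ 0 := by
    have : r ≠ 0 := by omega
    exact_mod_cast this
  have hμ := starMean_eq hr n p
  have hch := chooseRatio_mul_pow_le hnr
  rw [← hκdef] at hch
  have hμκ : κ * (n * (n * (p : ℝ)) ^ r) ≤ starMean r n p := by
    rw [hμ, mul_pow]
    calc κ * (n * ((n : ℝ) ^ r * (p : ℝ) ^ r)) = n * ((κ * (n : ℝ) ^ r) * (p : ℝ) ^ r) := by ring
      _ ≤ _ := by gcongr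
  have hμ0 : 0 < starMean r n p := lt_of_lt_of_le (by positivity) hμκ
  obtain ⟨μ, hμdef⟩ : ∃ x, x = starMean r n p := ⟨_, rfl⟩
  have hΛ : starLambda r n p = μ * (1 + (n * (p : ℝ)) ^ (r - 1)) := by rw [starLambda, hμdef]
  rw [hΛ, ← hμdef]
  rw [← hμdef] at hμ0 hμκ
  obtain ⟨D, hD⟩ : ∃ x, x = 1 + (n * (p : ℝ)) ^ (r - 1) := ⟨_, rfl⟩
  have hD0 : 0 < D := by rw [hD]; positivity
  have hx0 : 0 ≤ t / μ := by positivity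
  have hφ0 := phi_nonneg hx0
  have hL : Real.log (Real.exp 1 / (p : ℝ)) = 1 - Real.log p := by
    rw [Real.log_div (Real.exp_pos _).ne' hp0.ne', Real.log_exp]
  have hL0 : 0 ≤ 1 - Real.log (p : ℝ) := by linarith [Real.log_nonpos hp0.le hp1]
  have hM0 : 0 ≤ clusterM r n t := le_max_of_le_left (by positivity)
  rw [hL, ← hD]
  obtain ⟨I, hI⟩ : ∃ x, x = min (phi (t / μ) * μ ^ 2 / (μ * D))
    (clusterM r n t * (1 - Real.log p)) := ⟨_, rfl⟩
  rw [← hI]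
  have hI0 : 0 ≤ I := by rw [hI]; exact le_min (by positivity) (by positivity)
  -- With Λ = μD, the first term of the minimum is φ(t/μ)μ/D, and φ(x) ≤ x log(1+x).
  have hI1 : I * D ≤ t * Real.log (1 + t / μ) := by
    have h1 : I ≤ phi (t / μ) * μ ^ 2 / (μ * D) := by rw [hI]; exact min_le_left _ _
    calc I * D ≤ phi (t / μ) * μ ^ 2 / (μ * D) * D := by gcongr
      _ = phi (t / μ) * μ := by field_simp
      _ ≤ (t / μ * Real.log (1 + t / μ)) * μ := by
        gcongr; exact phi_le_mul_log hx0
      _ = _ := by field_simp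
  obtain ⟨τ, hτ⟩ : ∃ x : ℝ, x = t ^ (1 / (r : ℝ)) := ⟨_, rfl⟩
  have hτ0 : 0 < τ := by rw [hτ]; positivity
  have hτr : τ ^ r = t := by
    rw [hτ, ← Real.rpow_natCast, ← Real.rpow_mul ht.le, one_div_mul_cancel hr0, Real.rpow_one]
  have hI2 : I * (min τ n) ^ (r - 1) ≤ t * (1 - Real.log p) := by
    have h1 : I ≤ clusterM r n t * (1 - Real.log p) := by rw [hI]; exact min_le_right _ _
    have h2 := clusterM_mul_min_pow_le (by omega : 1 ≤ r) hn ht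
    rw [← hτ] at h2
    have hT0 : 0 ≤ min τ (n : ℝ) := le_min hτ0.le hn0.le
    calc I * (min τ n) ^ (r - 1) ≤ clusterM r n t * (1 - Real.log p) * (min τ n) ^ (r - 1) := by
          gcongr
      _ = clusterM r n t * (min τ n) ^ (r - 1) * (1 - Real.log p) := by ring
      _ ≤ _ := by gcongr
  -- Chosen so that the exponent λt/2 equals cI with c = η₀/2; the bounds `hI1` and `hI2` then
  -- become the two constraints on λ.
  obtain ⟨lam, hlamdef⟩ : ∃ x, x = η₀ * I / t := ⟨_, rfl⟩
  have hlam : 0 ≤ lam := by rw [hlamdef]; positivity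
  have hl1 : lam * D ≤ η₀ * Real.log (1 + t / μ) := by
    rw [hlamdef, div_mul_eq_mul_div, div_le_iff₀ ht]
    have := mul_le_mul_of_nonneg_left hI1 hη₀.le
    linarith
  have hl1' : lam * (1 + (n * (p : ℝ)) ^ (r - 1)) ≤
      η₀ * Real.log (1 + τ ^ r / (κ * (n * (n * (p : ℝ)) ^ r))) := by
    rw [← hD, hτr]
    refine hl1.trans ?_
    gcongr
  have hl2 : lam * (min τ n) ^ (r - 1) ≤ η₀ * (1 - Real.log p) := by
    rw [hlamdef, div_mul_eq_mul_div, div_le_iff₀ ht]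
    have := mul_le_mul_of_nonneg_left hI2 hη₀.le
    linarith
  obtain ⟨K, hK⟩ := htrunc n p τ lam η₀ hη₀ i1 (by omega) hp0 hp1 hτ0 hlam hl1' hl2
  rw [hτr] at hK
  have hfin := hmain n p t lam K hnr hp0 ht hlam (by
    rw [← hD, ← hμdef]
    refine hl1.trans (mul_le_mul_of_nonneg_right (by linarith) ?_)
    exact Real.log_nonneg (by linarith))
    (fun h1 => mul_pow_le_of_dense hr hκ hη₀.le i2 i3 hn hp0 hp1 hτ0 hlam h1 hl1' hl2) hK
  rw [← hμdef] at hfin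
  have e : lam * t / 2 = η₀ / 2 * I := by rw [hlamdef]; field_simp
  rwa [e] at hfin

theorem theorem4 (r : ℕ) (hr : 2 ≤ r) (γ : ℝ) (hγ : 0 < γ) :
    ∃ c : ℝ, 0 < c ∧
      ∀ (n : ℕ) (p : unitInterval) (t : ℝ), 1 ≤ n → 0 < (p : ℝ) → 0 < t →
        ((n : ℝ) * (p : ℝ) ∉ Set.Ioo ((n : ℝ) ^ (-γ)) (γ * Real.log n) ∨
          DeviationCondition r n γ p t) →
        starUpperTail r n p (starMean r n p + t) ≤
          (1 + (n : ℝ)⁻¹) *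
            Real.exp (-(c *
              min (phi (t / starMean r n p) * starMean r n p ^ 2 / starLambda r n p)
                (clusterM r n t * Real.log (Real.exp 1 / (p : ℝ))))) := by
  obtain ⟨c, hc, h⟩ := exists_starUpperTail_le r hr
  exact ⟨c, hc, fun n p t _ hp ht _ => h n p t hp ht⟩
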